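/- **Conventions.** A locale is given by its frame. A geometric theory $T$ over a set $G$ of generators consists of axioms $\bigwedge A\vdash\bigvee_{i\in I}\bigwedge B_i$ with $A,B_i\subseteq G$ finite. An interpretation of $T$ in a frame $L$ is a map $f:G\to L$ with $\bigwedge_{a\in A}f(a)\le\bigvee_{i}\bigwedge_{b\in B_i}f(b)$ for every axiom; a model is a subset $\alpha\subseteq G$ such that, for every axiom, $A\subseteq\alpha$ implies $B_i\subseteq\alpha$ for some $i$. A frame $F$ is presented by $T$ via $i:G\to F$ if $i$ is an interpretation and every interpretation $f:G\to L$ in a frame $L$ is $h\circ i$ for a unique frame homomorphism $h:F\to L$. A strong proximity lattice is a bounded distributive lattice $S$ with a relation $\prec$ such that $\{a\mid a\prec b\}$ is an ideal and $\{b\mid a\prec b\}$ is a filter, ${\prec}\circ{\prec}={\prec}$, and: $a\prec 0$ implies $a=0$; $1\prec a$ implies $a=1$; $a\prec b\vee c$ implies $a\le b'\vee c'$ for some $b'\prec b$, $c'\prec c$; $b\wedge c\prec a$ implies $b'\wedge c'\le a$ for some $b'\succ b$, $c'\succ c$. $\mathrm{Spec}(S)$ is the locale whose frame consists of the ideals $I$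 of $S$ with $a\in I\iff\exists b\succ a\,(b\in I)$, ordered by inclusion; ${\downarrow_\prec}a=\{b\mid b\prec a\}$. A strong continuous entailment relation $(G,\vdash,\prec)$ is a relation $\vdash$ on finite subsets of $G$ with $a\vdash a$, closed under weakening ($A\vdash B$ implies $A',A\vdash B,B'$) and cut ($A\vdash B,a$ and $a,A\vdash B$ imply $A\vdash B$), together with an idempotent relation $\prec$ on $G$ such that for all finite $A,B$: $\exists A'\,(A\prec_U A'\vdash B)\iff\exists B'\,(A\vdash B'\prec_L B)$, where $A\prec_U A'$ means $\forall b\in A'\,\exists a\in A\,(a\prec b)$ and $B'\prec_L B$ means $\forall a\in B'\,\exists b\in B\,(a\prec b)$. It presents the locale presented by the theory with axioms $\bigwedge A\vdash\bigvee B$ (if $A\vdash B$), $a\vdash b$ (if $a\prec b$), and $a\vdash\bigvee_{b\prec a}b$. For a locale $X$, a valuation is a Scott continuous map $\mu$ from the frame of $X$ to the lower reals in $[0,\infty]$ with $\mu(0)=0$ and $\mu(x)+\mu(y)=\mu(x\wedge y)+\mu(x\vee y)$; a covaluation is a Scott continuous map $\nu$ to the upper reals in $[0,\infty]$ (ordered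 by inclusion of the sets $\{p\in\mathbb Q\mid\nu(x)<p\}$) with $\nu(1)=0$ and the same modular law. They are probabilistic if $\mu(1)=1$, respectively $\nu(0)=1$. $\mathfrak V(X)$, $\mathfrak C(X)$, $\mathfrak V_P(X)$, $\mathfrak C_P(X)$ denote the locales of valuations, covaluations, probabilistic valuations and probabilistic covaluations on $X$, i.e. the locales presented by the geometric theories, with generators $\langle p,x\rangle$ for $p\in\mathbb Q$ and $x$ in the frame of $X$ (read as $p<\mu(x)$, respectively $\nu(x)<p$), that express these conditions. **Theories.** Let $S$ be a strong proximity lattice and $S_{\mathfrak V}=\{\langle p,a\rangle\mid p\in\mathbb Q,\ a\in S\}$. Put $\langle p,a\rangle\prec_{\mathfrak V}\langle q,b\rangle$ iff $q<p$ and $a\prec b$, and $\langle p,a\rangle\prec_{\mathfrak C}\langle q,b\rangle$ iff $p<q$ and $a\prec b$. The theory $T_{\mathfrak V}$ over $S_{\mathfrak V}$ has the axioms (V) $\top\vdash\langle p,a\rangle$ ($p<0$); $\langle p,0\rangle\vdash\bot$ ($0<p$); $\langle p,a\rangle\vdash\langle q,b\rangle$ ($q\le p$, $a\le b$); $\langle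 p,a\rangle\vdash\langle q,b\rangle$ ($q<p$, $a\prec b$); $\langle p,a\rangle\vdash\bigvee_{p<q,\,b\prec a}\langle q,b\rangle$; and the modular law (M1) $\langle p,a\rangle\wedge\langle q,b\rangle\vdash\bigvee_{p'+q'=p+q}\langle p',a\wedge b\rangle\wedge\langle q',a\vee b\rangle$, (M2) $\langle p,a\wedge b\rangle\wedge\langle q,a\vee b\rangle\vdash\bigvee_{p'+q'=p+q}\langle p',a\rangle\wedge\langle q',b\rangle$. The theory $T_{\mathfrak C}$ has the axioms (C) $\langle p,a\rangle\vdash\bot$ ($p<0$); $\top\vdash\langle p,1\rangle$ ($0<p$); $\langle p,a\rangle\vdash\langle q,b\rangle$ ($p\le q$, $a\le b$); $\langle p,a\rangle\vdash\langle q,b\rangle$ ($p<q$, $a\prec b$); $\langle p,a\rangle\vdash\bigvee_{q<p,\,b\prec a}\langle q,b\rangle$; and (M1), (M2). The theories $T_{\mathfrak V_P}$ and $T_{\mathfrak C_P}$ extend $T_{\mathfrak V}$ and $T_{\mathfrak C}$, respectively, by (VP) $\langle p,a\rangle\vdash\bot$ ($1<p$), $\top\vdash\langle p,1\rangle$ ($p<1$);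 (CP) $\top\vdash\langle p,a\rangle$ ($1<p$), $\langle p,0\rangle\vdash\bot$ ($p<1$). Finally consider, for $p+q=r+s$, (D1) $\langle p,a\rangle\wedge\langle q,b\rangle\vdash\langle r,a\wedge b\rangle\vee\langle s,a\vee b\rangle$, (D2) $\langle r,a\wedge b\rangle\wedge\langle s,a\vee b\rangle\vdash\langle p,a\rangle\vee\langle q,b\rangle$. **Theorem.** Let $S$ be a strong proximity lattice. 1. For every frame $L$ and every map $f:S_{\mathfrak V}\to L$ that satisfies the axioms of $T_{\mathfrak V}$ other than (M1), (M2), or the axioms of $T_{\mathfrak C}$ other than (M1), (M2): $f$ satisfies (M1) iff it satisfies (D1), and $f$ satisfies (M2) iff it satisfies (D2). 2. Let $\vdash_{\mathfrak V}$, $\vdash_{\mathfrak C}$, $\vdash_{\mathfrak V_P}$, $\vdash_{\mathfrak C_P}$ be the smallest entailment relations on $S_{\mathfrak V}$ that contain, respectively, the axioms (V), (D1), (D2); (C), (D1), (D2); (V), (D1), (D2), (VP); (C), (D1), (D2), (CP) (read as entailments between finite sets). Then $(S_{\mathfrak V},\vdash_{\mathfrak V},\prec_{\mathfrak V})$, $(S_{\mathfrak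 V},\vdash_{\mathfrak C},\prec_{\mathfrak C})$, $(S_{\mathfrak V},\vdash_{\mathfrak V_P},\prec_{\mathfrak V})$ and $(S_{\mathfrak V},\vdash_{\mathfrak C_P},\prec_{\mathfrak C})$ are strong continuous entailment relations, and they present the locales $\mathfrak V(\mathrm{Spec}\,S)$, $\mathfrak C(\mathrm{Spec}\,S)$, $\mathfrak V_P(\mathrm{Spec}\,S)$ and $\mathfrak C_P(\mathrm{Spec}\,S)$, respectively, via $\langle p,a\rangle\mapsto\langle p,{\downarrow_\prec}a\rangle$. The theories $T_{\mathfrak V}$, $T_{\mathfrak C}$, $T_{\mathfrak V_P}$, $T_{\mathfrak C_P}$ present the same locales via the same map. In each of the four cases, assigning to $\mu$ the set $\{\langle q,a\rangle\mid q\in\mu({\downarrow_\prec}a)\}$ (lower and upper reals being regarded as sets of rationals) is a bijection from the valuations (covaluations, probabilistic valuations, probabilistic covaluations) on $\mathrm{Spec}\,S$ to the models of the theory of the entailment relation. 3. These four locales are stably compact. More generally, for every stably compact locale $X$ the locales $\mathfrak V(X)$, $\mathfrak C(X)$, $\mathfrak V_P(X)$ and $\mathfrak C_P(X)$ are stably compact.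 -/

import Mathlib

universe u v w

/- Point-free topology: a locale is given by its frame. The frame of a locale is an `Order.Frame`,
and locale maps are frame homomorphisms in the opposite direction. -/

namespace PointFree

/-! ### Geometric theories and the locales they present -/

/-- A geometric theory over a set `G` of generators: `T A 𝓑` says that
`⋀ A ⊢ ⋁ (B ∈ 𝓑) ⋀ B` is an axiom of `T`. The union of two theories is their supremum `⊔`. -/
abbrev GeometricTheory (G : Type u) := Finset G → Set (Finset G) → Prop

/-- `f` is an interpretation of the geometric theory `T` in the locale with frame `L`. -/
def IsInterpretation {G : Type u} (T : GeometricTheory G) {L : Type v} [Order.Frame L]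
    (f : G → L) : Prop :=
  ∀ A 𝓑, T A 𝓑 → A.inf f ≤ ⨆ B ∈ 𝓑, B.inf f

/-- `α` is a model of the geometric theory `T`. -/
def IsModel {G : Type u} (T : GeometricTheory G) (α : Set G) : Prop :=
  ∀ A 𝓑, T A 𝓑 → (A : Set G) ⊆ α → ∃ B ∈ 𝓑, (B : Set G) ⊆ α

/-- The locale with frame `F` is presented by the geometric theory `T`, with universal
interpretation `i` (universal for frames in the universe `w`). -/
def IsPresentedBy {G : Type u} (T : GeometricTheory G) {F : Type v} [Order.Frame F]
    (i : G → F) : Prop :=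
  IsInterpretation T i ∧
    ∀ (L : Type w) [Order.Frame L] (f : G → L), IsInterpretation T f →
      ∃! h : FrameHom F L, ∀ g, h (i g) = f g

/-- The frame freely generated by `G`: the lower sets of the free meet-semilattice over `G`, which
is the set of finite subsets of `G` ordered by reverse inclusion. -/
abbrev FreeFrame (G : Type u) := LowerSet (Finset G)ᵒᵈ

/-- The inclusion of the generators in the free frame. -/
def freeGen {G : Type u} (g : G) : FreeFrame G where
  carrier := {A | g ∈ OrderDual.ofDual A}
  lower' := fun _ _ h hA => h hA

/-- The quotient of the free frame by the axioms of `T`, as a sublocale. -/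
def theorySublocale {G : Type u} (T : GeometricTheory G) : Sublocale (FreeFrame G) where
  carrier := {U | ∀ A 𝓑, T A 𝓑 → ∀ W : FreeFrame G,
    (⨆ B ∈ 𝓑, B.inf freeGen) ⊓ W ≤ U → A.inf freeGen ⊓ W ≤ U}
  sInf_mem' := fun _ hs A 𝓑 hT W h =>
    le_sInf fun U hU => hs hU A 𝓑 hT W (h.trans (sInf_le hU))
  himp_mem' := fun X U hU A 𝓑 hT W h => by
    rw [le_himp_iff, inf_assoc] at h ⊢
    exact hU A 𝓑 hT _ h

/-- The frame of the locale presented by the geometric theory `T`. -/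
abbrev Space {G : Type u} (T : GeometricTheory G) : Type u := theorySublocale T

/-- The universal interpretation of `T` in the locale that it presents. -/
def Space.gen {G : Type u} (T : GeometricTheory G) (g : G) : Space T :=
  (theorySublocale T).restrict (freeGen g)

theorem mem_inf_freeGen {G : Type u} (A B : Finset G) :
    OrderDual.toDual B ∈ A.inf freeGen ↔ A ⊆ B := by
  classical
  induction A using Finset.induction_on with
  | empty => simp
  | insert a s _ ih =>
    rw [Finset.inf_insert, LowerSet.mem_inf_iff, ih, Finset.insert_subset_iff]
    rfl

/-- The extension of a map on generators to the free frame. -/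
def freeLift {G : Type u} {L : Type v} [Order.Frame L] (f : G → L) : FrameHom (FreeFrame G) L where
  toFun U := ⨆ A ∈ U, (OrderDual.ofDual A).inf f
  map_inf' U V := by
    classical
    change (⨆ A ∈ U ⊓ V, (OrderDual.ofDual A).inf f) =
      (⨆ A ∈ U, (OrderDual.ofDual A).inf f) ⊓ ⨆ A ∈ V, (OrderDual.ofDual A).inf f
    refine le_antisymm (iSup₂_le fun A hA => le_inf ?_ ?_) ?_
    · exact le_iSup₂_of_le A hA.1 le_rfl
    · exact le_iSup₂_of_le A hA.2 le_rfl
    · rw [iSup₂_inf_eq]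
      refine iSup₂_le fun A hA => ?_
      rw [inf_iSup₂_eq]
      refine iSup₂_le fun B hB => ?_
      rw [← Finset.inf_union]
      refine le_iSup₂_of_le
        (OrderDual.toDual (OrderDual.ofDual A ∪ OrderDual.ofDual B)) ⟨?_, ?_⟩ le_rfl
      · exact U.lower (a := A) Finset.subset_union_left hA
      · exact V.lower (a := B) Finset.subset_union_right hB
  map_top' := top_le_iff.1 (le_iSup₂_of_le (OrderDual.toDual ∅) trivial (by simp))
  map_sSup' s := by
    refine le_antisymm (iSup₂_le fun A hA => ?_) (sSup_le ?_)
    · obtain ⟨U, hU, hAU⟩ := LowerSet.mem_sSup_iff.1 hA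
      exact le_sSup_of_le ⟨U, hU, rfl⟩ (le_iSup₂_of_le A hAU le_rfl)
    · rintro _ ⟨U, hU, rfl⟩
      exact iSup₂_le fun A hA => le_iSup₂_of_le A (LowerSet.mem_sSup_iff.2 ⟨U, hU, hA⟩) le_rfl

theorem map_finset_inf {G : Type u} {F : Type v} {L : Type w} [Order.Frame F] [Order.Frame L]
    (h : FrameHom F L) (A : Finset G) (f : G → F) : h (A.inf f) = A.inf fun g => h (f g) :=
  Finset.apply_inf_eq_inf_comp h (map_inf h) (map_top h)

theorem freeLift_gen {G : Type u} {L : Type v} [Order.Frame L] (f : G → L) (g : G) :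
    freeLift f (freeGen g) = f g := by
  refine le_antisymm (iSup₂_le fun A hA => Finset.inf_le hA) ?_
  exact le_iSup₂_of_le (OrderDual.toDual {g}) (Finset.mem_singleton_self g) (by simp)

theorem eq_iSup_inf_freeGen {G : Type u} (U : FreeFrame G) :
    U = ⨆ A ∈ U, (OrderDual.ofDual A).inf freeGen := by
  refine le_antisymm (fun A hA => ?_) (iSup₂_le fun A hA B hB => ?_)
  · have h : (OrderDual.ofDual A).inf freeGen ≤ ⨆ A ∈ U, (OrderDual.ofDual A).inf freeGen :=
      le_iSup₂_of_le A hA le_rfl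
    exact h ((mem_inf_freeGen _ (OrderDual.ofDual A)).2 subset_rfl)
  · exact U.lower ((mem_inf_freeGen _ (OrderDual.ofDual B)).1 hB) hA

/-- The locale `Space T` is presented by `T`. -/
theorem Space.isPresentedBy {G : Type u} (T : GeometricTheory G) :
    IsPresentedBy.{u, u, w} T (Space.gen T) := by
  set S := theorySublocale T with hS
  have hgi := S.giRestrict
  refine ⟨fun A 𝓑 hT => ?_, fun L _ f hf => ?_⟩
  · have e : ∀ B : Finset G, B.inf (Space.gen T) = S.restrict (B.inf freeGen) :=
      fun B => (map_finset_inf S.restrict B freeGen).symm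
    simp only [e]
    rw [← map_iSup₂]
    have hmem := (S.restrict (⨆ B ∈ 𝓑, B.inf freeGen)).2 A 𝓑 hT ⊤
      (by rw [inf_top_eq]; exact hgi.gc.le_u_l _)
    rw [inf_top_eq] at hmem
    exact hgi.gc.l_le hmem
  · set h₀ := freeLift f
    have hinf : ∀ B : Finset G, h₀ (B.inf freeGen) = B.inf f := fun B => by
      rw [map_finset_inf]; simp only [h₀, freeLift_gen]
    -- the frame homomorphism on the free frame does not see the closure
    have key : ∀ U : FreeFrame G, h₀ (S.restrict U) ≤ h₀ U := by
      intro U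
      have hm : sSup {V | h₀ V ≤ h₀ U} ∈ S := by
        intro A 𝓑 hT W hW
        refine le_sSup ?_
        have h1 : h₀ (sSup {V | h₀ V ≤ h₀ U}) ≤ h₀ U := by
          rw [map_sSup]; exact sSup_le (by rintro _ ⟨V, hV, rfl⟩; exact hV)
        have h2 := (OrderHomClass.mono h₀ hW).trans h1
        simp only [map_inf, map_iSup₂, hinf] at h2
        change h₀ (A.inf freeGen ⊓ W) ≤ _
        rw [map_inf, hinf]
        exact (inf_le_inf_right _ (hf A 𝓑 hT)).trans h2
      have h3 : S.restrict U ≤ ⟨_, hm⟩ := (hgi.gc _ _).2 (le_sSup (le_refl (h₀ U)))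
      have h4 : h₀ (S.restrict U) ≤ h₀ (sSup {V | h₀ V ≤ h₀ U}) := OrderHomClass.mono h₀ h3
      refine h4.trans ?_
      rw [map_sSup]
      exact sSup_le (by rintro _ ⟨V, hV, rfl⟩; exact hV)
    have hgen : ∀ U : FreeFrame G, h₀ (S.restrict U) = h₀ U := fun U =>
      le_antisymm (key U) (OrderHomClass.mono h₀ (hgi.gc.le_u_l U))
    refine ⟨{ toFun := fun U => h₀ U
              map_inf' := fun U V => map_inf h₀ (U : FreeFrame G) V
              map_top' := map_top h₀
              map_sSup' := fun s => ?_ }, fun g => ?_, fun k hk => ?_⟩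
    · have e : sSup s = S.restrict (sSup (Subtype.val '' s)) := by
        rw [map_sSup, Set.image_image]
        simp
      rw [e, hgen, map_sSup, Set.image_image]
    · exact (hgen _).trans (freeLift_gen f g)
    · ext U
      have e : U = S.restrict (U : FreeFrame G) := (hgi.l_u_eq U).symm
      have e2 : k (S.restrict (U : FreeFrame G)) = h₀ U := by
        conv_lhs => rw [eq_iSup_inf_freeGen (U : FreeFrame G)]
        simp only [map_iSup₂, map_finset_inf]
        change _ = ⨆ A ∈ (U : FreeFrame G), (OrderDual.ofDual A).inf f
        exact iSup_congr fun A => iSup_congr fun _ => Finset.inf_congr rfl fun g _ => hk g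
      rw [e, e2, ← e]
      rfl

/-! ### Stably compact locales -/

/-- The way-below relation. -/
def WayBelow {L : Type u} [CompleteLattice L] (a b : L) : Prop :=
  ∀ D : Set L, D.Nonempty → DirectedOn (· ≤ ·) D → b ≤ sSup D → ∃ d ∈ D, a ≤ d

/-- A stably compact locale: a compact, locally compact locale whose way-below relation is stable
under binary meets. -/
structure IsStablyCompact (L : Type u) [Order.Frame L] : Prop where
  compact : WayBelow (⊤ : L) ⊤
  continuous : ∀ b : L, b = sSup {a | WayBelow a b}
  stable : ∀ a b c : L, WayBelow a b → WayBelow a c → WayBelow a (b ⊓ c)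

/-! ### Strong proximity lattices and their spectra -/

/-- A strong proximity lattice: a bounded distributive lattice with an idempotent join-preserving
proximity relation `prec` that satisfies the two dual conditions as well. -/
class StrongProximityLattice (S : Type u) [DistribLattice S] [BoundedOrder S] where
  prec : S → S → Prop
  -- the elements below a given one form an ideal
  prec_of_le_of_prec : ∀ {a b c : S}, a ≤ b → prec b c → prec a c
  bot_prec : ∀ a : S, prec ⊥ a
  sup_prec : ∀ {a b c : S}, prec a c → prec b c → prec (a ⊔ b) c
  -- the elements above a given one form a filter
  prec_of_prec_of_le : ∀ {a b c : S}, prec a b → b ≤ c → prec a c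
  prec_top : ∀ a : S, prec a ⊤
  prec_inf : ∀ {a b c : S}, prec a b → prec a c → prec a (b ⊓ c)
  -- idempotence
  prec_iff_exists : ∀ a c : S, prec a c ↔ ∃ b, prec a b ∧ prec b c
  -- preservation of finite joins, and the dual conditions
  eq_bot_of_prec_bot : ∀ {a : S}, prec a ⊥ → a = ⊥
  exists_of_prec_sup : ∀ {a b c : S}, prec a (b ⊔ c) →
    ∃ b' c', a ≤ b' ⊔ c' ∧ prec b' b ∧ prec c' c
  eq_top_of_top_prec : ∀ {a : S}, prec ⊤ a → a = ⊤
  exists_of_inf_prec : ∀ {a b c : S}, prec (b ⊓ c) a →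
    ∃ b' c', prec b b' ∧ prec c c' ∧ b' ⊓ c' ≤ a

infix:50 " ≺ " => StrongProximityLattice.prec

open StrongProximityLattice

section Spec

variable (S : Type u) [DistribLattice S] [BoundedOrder S] [StrongProximityLattice S]

/-- Rounded ideals of a strong proximity lattice. -/
@[ext]
structure RoundedIdeal where
  carrier : Set S
  lower : ∀ {a b : S}, a ≤ b → b ∈ carrier → a ∈ carrier
  bot_mem : ⊥ ∈ carrier
  sup_mem : ∀ {a b : S}, a ∈ carrier → b ∈ carrier → a ⊔ b ∈ carrier
  rounded : ∀ a : S, a ∈ carrier ↔ ∃ b, a ≺ b ∧ b ∈ carrier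

variable {S}

namespace RoundedIdeal

instance : PartialOrder (RoundedIdeal S) where
  le I J := I.carrier ⊆ J.carrier
  le_refl _ := subset_rfl
  le_trans _ _ _ := Set.Subset.trans
  le_antisymm _ _ h k := RoundedIdeal.ext (Set.Subset.antisymm h k)

/-- The rounded ideal `{b | b ≺ a}`. -/
def down (a : S) : RoundedIdeal S where
  carrier := {b | b ≺ a}
  lower := prec_of_le_of_prec
  bot_mem := bot_prec a
  sup_mem := sup_prec
  rounded b := prec_iff_exists b a

/-- Finite meets of rounded ideals are intersections. -/
def inter (I J : RoundedIdeal S) : RoundedIdeal S where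
  carrier := I.carrier ∩ J.carrier
  lower h k := ⟨I.lower h k.1, J.lower h k.2⟩
  bot_mem := ⟨I.bot_mem, J.bot_mem⟩
  sup_mem h k := ⟨I.sup_mem h.1 k.1, J.sup_mem h.2 k.2⟩
  rounded a := by
    constructor
    · rintro ⟨hI, hJ⟩
      obtain ⟨b, hb, hbI⟩ := (I.rounded a).1 hI
      obtain ⟨c, hc, hcJ⟩ := (J.rounded a).1 hJ
      exact ⟨b ⊓ c, prec_inf hb hc, I.lower inf_le_left hbI, J.lower inf_le_right hcJ⟩
    · rintro ⟨b, hb, hbI, hbJ⟩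
      exact ⟨(I.rounded a).2 ⟨b, hb, hbI⟩, (J.rounded a).2 ⟨b, hb, hbJ⟩⟩

theorem finset_sup_mem (I : RoundedIdeal S) (F : Finset S) (h : ∀ a ∈ F, a ∈ I.carrier) :
    F.sup id ∈ I.carrier :=
  Finset.sup_induction I.bot_mem (fun _ ha _ hb => I.sup_mem ha hb) h

/-- Joins of rounded ideals. -/
def sSup' (s : Set (RoundedIdeal S)) : RoundedIdeal S where
  carrier := {x | ∃ F : Finset S, (∀ a ∈ F, ∃ I ∈ s, a ∈ I.carrier) ∧ x ≺ F.sup id}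
  lower := fun h ⟨F, hF, hx⟩ => ⟨F, hF, prec_of_le_of_prec h hx⟩
  bot_mem := ⟨∅, by simp, bot_prec _⟩
  sup_mem := by
    classical
    rintro a b ⟨F, hF, ha⟩ ⟨H, hH, hb⟩
    refine ⟨F ∪ H, fun c hc => (Finset.mem_union.1 hc).elim (hF c) (hH c), ?_⟩
    rw [Finset.sup_union]
    exact sup_prec (prec_of_prec_of_le ha le_sup_left) (prec_of_prec_of_le hb le_sup_right)
  rounded a := by
    constructor
    · rintro ⟨F, hF, ha⟩
      obtain ⟨b, hab, hb⟩ := (prec_iff_exists _ _).1 ha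
      exact ⟨b, hab, F, hF, hb⟩
    · rintro ⟨b, hab, F, hF, hb⟩
      exact ⟨F, hF, (prec_iff_exists _ _).2 ⟨b, hab, hb⟩⟩

instance : SupSet (RoundedIdeal S) := ⟨sSup'⟩

theorem isLUB_sSup' (s : Set (RoundedIdeal S)) : IsLUB s (sSup s) := by
  constructor
  · intro I hI x hx
    obtain ⟨b, hb, hbI⟩ := (I.rounded x).1 hx
    exact ⟨{b}, by simpa using ⟨I, hI, hbI⟩, by simpa using hb⟩
  · rintro J hJ x ⟨F, hF, hx⟩
    refine (J.rounded x).2 ⟨_, hx, J.finset_sup_mem F fun a ha => ?_⟩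
    obtain ⟨I, hI, haI⟩ := hF a ha
    exact hJ hI haI

instance : CompleteLattice (RoundedIdeal S) where
  __ := completeLatticeOfSup (RoundedIdeal S) isLUB_sSup'
  inf := inter
  inf_le_left _ _ := Set.inter_subset_left
  inf_le_right _ _ := Set.inter_subset_right
  le_inf _ _ _ h k := Set.subset_inter h k

/-- The rounded ideals, ordered by inclusion, form a frame: the frame of the locale `Spec S`. -/
instance : Order.Frame (RoundedIdeal S) := .ofMinimalAxioms
  { inf_sSup_le_iSup_inf := by
      classical
      rintro I s x ⟨hxI, F, hF, hx⟩
      obtain ⟨z, hxz, hz⟩ := (I.rounded x).1 hxI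
      have h : x ≺ F.sup fun a => z ⊓ a := by
        rw [← Finset.sup_inf_distrib_left]
        exact prec_inf hxz hx
      refine ((⨆ J ∈ s, I ⊓ J).rounded x).2 ⟨_, h, ?_⟩
      refine Finset.sup_induction (p := fun y => y ∈ (⨆ J ∈ s, I ⊓ J).carrier)
        (RoundedIdeal.bot_mem _) (fun _ ha _ hb => RoundedIdeal.sup_mem _ ha hb) ?_
      intro a ha
      obtain ⟨J, hJ, haJ⟩ := hF a ha
      have hle : I ⊓ J ≤ ⨆ J ∈ s, I ⊓ J := le_iSup₂_of_le J hJ le_rfl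
      exact hle ⟨I.lower inf_le_left hz, J.lower inf_le_right haJ⟩ }

end RoundedIdeal

end Spec

/-- The frame of the locale `Spec S`. -/
abbrev Spec (S : Type u) [DistribLattice S] [BoundedOrder S] [StrongProximityLattice S] : Type u :=
  RoundedIdeal S

/-! ### Strong continuous entailment relations -/

open Classical in
/-- Entailment relations on a set `G`. -/
structure IsEntailmentRelation {G : Type u} (E : Finset G → Finset G → Prop) : Prop where
  refl : ∀ a, E {a} {a}
  mono : ∀ A A' B B', E A B → E (A' ∪ A) (B ∪ B')
  cut : ∀ A B a, E A (insert a B) → E (insert a A) B → E A B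

/-- The smallest entailment relation that contains a set `E₀` of axioms. -/
def generatedEntailment {G : Type u} (E₀ : Finset G → Finset G → Prop) (A B : Finset G) : Prop :=
  ∀ E : Finset G → Finset G → Prop, IsEntailmentRelation E → (∀ C D, E₀ C D → E C D) → E A B

/-- `A ≺_L B`. -/
def LowerExt {G : Type u} (r : G → G → Prop) (A B : Finset G) : Prop := ∀ a ∈ A, ∃ b ∈ B, r a b

/-- `A ≺_U B`. -/
def UpperExt {G : Type u} (r : G → G → Prop) (A B : Finset G) : Prop := ∀ b ∈ B, ∃ a ∈ A, r a b

/-- Strong continuous entailment relations `(G, E, r)`. -/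
structure IsStrongContEnt {G : Type u} (E : Finset G → Finset G → Prop) (r : G → G → Prop) :
    Prop where
  entailment : IsEntailmentRelation E
  idempotent : ∀ a c, r a c ↔ ∃ b, r a b ∧ r b c
  continuous : ∀ A B, (∃ A', UpperExt r A A' ∧ E A' B) ↔ (∃ B', E A B' ∧ LowerExt r B' B)

/-- The axioms `⋀ A ⊢ ⋁ B`, for `E A B`. -/
inductive finitaryTheory {G : Type u} (E : Finset G → Finset G → Prop) : GeometricTheory G
  | intro (A B : Finset G) : E A B → finitaryTheory E A {C | ∃ b ∈ B, C = {b}}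

/-- The axioms `a ⊢ b`, for `r a b`, and `a ⊢ ⋁ (r b a) b`. -/
inductive roundTheory {G : Type u} (r : G → G → Prop) : GeometricTheory G
  | prec (a b : G) : r a b → roundTheory r {a} {{b}}
  | round (a : G) : roundTheory r {a} {C | ∃ b, r b a ∧ C = {b}}

/-- The geometric theory that a strong continuous entailment relation stands for. -/
def contEntTheory {G : Type u} (E : Finset G → Finset G → Prop) (r : G → G → Prop) :
    GeometricTheory G :=
  finitaryTheory E ⊔ roundTheory r

/-! ### Valuations and covaluations on a locale -/

/-- A lower real: a rounded downward closed set of rationals. -/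
def IsLowerReal (L : Set ℚ) : Prop := ∀ q, q ∈ L ↔ ∃ r ∈ L, q < r

/-- An upper real: a rounded upward closed set of rationals. -/
def IsUpperReal (U : Set ℚ) : Prop := ∀ q, q ∈ U ↔ ∃ r ∈ U, r < q

/-- The modular law, where addition of lower (or upper) reals is the pointwise one. -/
def IsModular {X : Type u} [Lattice X] (μ : X → Set ℚ) : Prop :=
  ∀ x y, Set.image2 (· + ·) (μ x) (μ y) = Set.image2 (· + ·) (μ (x ⊓ y)) (μ (x ⊔ y))

/-- Scott continuity for functions with values in lower (or upper) reals, ordered by inclusion. -/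
def IsScottCont {X : Type u} [CompleteLattice X] (μ : X → Set ℚ) : Prop :=
  ∀ D : Set X, D.Nonempty → DirectedOn (· ≤ ·) D → μ (sSup D) = ⋃ x ∈ D, μ x

/-- Valuations on a locale, with values in the lower reals in `[0, ∞]`. -/
structure IsValuation {X : Type u} [Order.Frame X] (μ : X → Set ℚ) : Prop where
  isLowerReal : ∀ x, IsLowerReal (μ x)
  nonneg : ∀ x, Set.Iio 0 ⊆ μ x
  scottCont : IsScottCont μ
  bot : μ ⊥ = Set.Iio 0
  modular : IsModular μ

/-- Covaluations on a locale, with values in the upper reals in `[0, ∞]` (`∅` is `∞`). -/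
structure IsCovaluation {X : Type u} [Order.Frame X] (ν : X → Set ℚ) : Prop where
  isUpperReal : ∀ x, IsUpperReal (ν x)
  nonneg : ∀ x, ν x ⊆ Set.Ioi 0
  scottCont : IsScottCont ν
  top : ν ⊤ = Set.Ioi 0
  modular : IsModular ν

/-- Probabilistic valuations: `μ 1 = 1`. -/
structure IsProbValuation {X : Type u} [Order.Frame X] (μ : X → Set ℚ) : Prop
    extends IsValuation μ where
  mass : μ ⊤ = Set.Iio 1

/-- Probabilistic covaluations: `ν 0 = 1`. -/
structure IsProbCovaluation {X : Type u} [Order.Frame X] (ν : X → Set ℚ) : Prop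
    extends IsCovaluation ν where
  mass : ν ⊥ = Set.Ioi 1

/-! ### The locales of valuations and covaluations on a locale -/

/-- The generators `⟨p, a⟩`. For valuations, `⟨p, a⟩` stands for `p < μ a`, for covaluations it
stands for `ν a < p`. -/
structure ValGen (S : Type u) where
  rat : ℚ
  elt : S

open Classical in
/-- Modular law, first half:
`⟨p, a⟩ ∧ ⟨q, b⟩ ⊢ ⋁ (p' + q' = p + q) ⟨p', a ∧ b⟩ ∧ ⟨q', a ∨ b⟩`. -/
inductive modularTheory₁ (S : Type u) [Lattice S] : GeometricTheory (ValGen S)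
  | intro (p q : ℚ) (a b : S) : modularTheory₁ S {⟨p, a⟩, ⟨q, b⟩}
      {C | ∃ p' q' : ℚ, p' + q' = p + q ∧ C = {⟨p', a ⊓ b⟩, ⟨q', a ⊔ b⟩}}

open Classical in
/-- Modular law, second half:
`⟨p, a ∧ b⟩ ∧ ⟨q, a ∨ b⟩ ⊢ ⋁ (p' + q' = p + q) ⟨p', a⟩ ∧ ⟨q', b⟩`. -/
inductive modularTheory₂ (S : Type u) [Lattice S] : GeometricTheory (ValGen S)
  | intro (p q : ℚ) (a b : S) : modularTheory₂ S {⟨p, a ⊓ b⟩, ⟨q, a ⊔ b⟩}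
      {C | ∃ p' q' : ℚ, p' + q' = p + q ∧ C = {⟨p', a⟩, ⟨q', b⟩}}

/-- Axioms on the generators for functions into the lower reals in `[0, ∞]` that are Scott
continuous and vanish at `0`. -/
inductive scottValTheory (X : Type u) [Order.Frame X] : GeometricTheory (ValGen X)
  | nonneg (p : ℚ) (x : X) : p < 0 → scottValTheory X ∅ {{⟨p, x⟩}}
  | bot (p : ℚ) : 0 < p → scottValTheory X {⟨p, ⊥⟩} ∅
  | mono (p q : ℚ) (x y : X) : q ≤ p → x ≤ y → scottValTheory X {⟨p, x⟩} {{⟨q, y⟩}}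
  | round (p : ℚ) (x : X) : scottValTheory X {⟨p, x⟩} {C | ∃ q, p < q ∧ C = {⟨q, x⟩}}
  | scott (p : ℚ) (D : Set X) : D.Nonempty → DirectedOn (· ≤ ·) D →
      scottValTheory X {⟨p, sSup D⟩} {C | ∃ x ∈ D, C = {⟨p, x⟩}}

/-- Axioms on the generators for functions into the upper reals in `[0, ∞]` that are Scott
continuous and vanish at `1`. -/
inductive scottCovalTheory (X : Type u) [Order.Frame X] : GeometricTheory (ValGen X)
  | nonneg (p : ℚ) (x : X) : p < 0 → scottCovalTheory X {⟨p, x⟩} ∅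
  | top (p : ℚ) : 0 < p → scottCovalTheory X ∅ {{⟨p, ⊤⟩}}
  | mono (p q : ℚ) (x y : X) : p ≤ q → x ≤ y → scottCovalTheory X {⟨p, x⟩} {{⟨q, y⟩}}
  | round (p : ℚ) (x : X) : scottCovalTheory X {⟨p, x⟩} {C | ∃ q, q < p ∧ C = {⟨q, x⟩}}
  | scott (p : ℚ) (D : Set X) : D.Nonempty → DirectedOn (· ≤ ·) D →
      scottCovalTheory X {⟨p, sSup D⟩} {C | ∃ x ∈ D, C = {⟨p, x⟩}}

/-- The axioms of total mass `1` for valuations: nothing exceeds `1`, and `μ 1 ≥ 1`. -/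
inductive probValTheory (S : Type u) [LE S] [OrderTop S] : GeometricTheory (ValGen S)
  | le_one (p : ℚ) (a : S) : 1 < p → probValTheory S {⟨p, a⟩} ∅
  | one_le (p : ℚ) : p < 1 → probValTheory S ∅ {{⟨p, ⊤⟩}}

/-- The axioms of total mass `1` for covaluations: nothing exceeds `1`, and `ν 0 ≥ 1`. -/
inductive probCovalTheory (S : Type u) [LE S] [OrderBot S] : GeometricTheory (ValGen S)
  | le_one (p : ℚ) (a : S) : 1 < p → probCovalTheory S ∅ {{⟨p, a⟩}}
  | one_le (p : ℚ) : p < 1 → probCovalTheory S {⟨p, ⊥⟩} ∅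

/-- The geometric theory of valuations on the locale with frame `X`. -/
def valuationTheory (X : Type u) [Order.Frame X] : GeometricTheory (ValGen X) :=
  scottValTheory X ⊔ modularTheory₁ X ⊔ modularTheory₂ X

/-- The geometric theory of covaluations on the locale with frame `X`. -/
def covaluationTheory (X : Type u) [Order.Frame X] : GeometricTheory (ValGen X) :=
  scottCovalTheory X ⊔ modularTheory₁ X ⊔ modularTheory₂ X

/-- The geometric theory of probabilistic valuations. -/
def probValuationTheory (X : Type u) [Order.Frame X] : GeometricTheory (ValGen X) :=
  valuationTheory X ⊔ probValTheory X

/-- The geometric theory of probabilistic covaluations. -/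
def probCovaluationTheory (X : Type u) [Order.Frame X] : GeometricTheory (ValGen X) :=
  covaluationTheory X ⊔ probCovalTheory X

/-- The (frame of the) locale of valuations on the locale with frame `X`. -/
abbrev Valuations (X : Type u) [Order.Frame X] : Type u := Space (valuationTheory X)

/-- The (frame of the) locale of covaluations on the locale with frame `X`. -/
abbrev Covaluations (X : Type u) [Order.Frame X] : Type u := Space (covaluationTheory X)

/-- The (frame of the) locale of probabilistic valuations on the locale with frame `X`. -/
abbrev ProbValuations (X : Type u) [Order.Frame X] : Type u := Space (probValuationTheory X)

/-- The (frame of the) locale of probabilistic covaluations on the locale with frame `X`. -/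
abbrev ProbCovaluations (X : Type u) [Order.Frame X] : Type u := Space (probCovaluationTheory X)

/-! ### Valuations on the spectrum of a strong proximity lattice, in terms of its elements -/

section

variable (S : Type u) [DistribLattice S] [BoundedOrder S] [StrongProximityLattice S]

/-- The generator `⟨p, a⟩` over `S` as a generator over `Spec S`, where `a` stands for the rounded
ideal of the elements `b ≺ a`. -/
def ValGen.toSpec {S : Type u} [DistribLattice S] [BoundedOrder S] [StrongProximityLattice S]
    (g : ValGen S) : ValGen (Spec S) :=
  ⟨g.rat, RoundedIdeal.down g.elt⟩

/-- The relation `q < p ∧ a ≺ b` between `⟨p, a⟩` and `⟨q, b⟩`. -/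
def valPrec (g h : ValGen S) : Prop := h.rat < g.rat ∧ g.elt ≺ h.elt

/-- The relation `p < q ∧ a ≺ b` between `⟨p, a⟩` and `⟨q, b⟩`. -/
def covalPrec (g h : ValGen S) : Prop := g.rat < h.rat ∧ g.elt ≺ h.elt

/-- The entailments for valuations other than the modular ones. -/
inductive valEnt : Finset (ValGen S) → Finset (ValGen S) → Prop
  | nonneg (p : ℚ) (a : S) : p < 0 → valEnt ∅ {⟨p, a⟩}
  | bot (p : ℚ) : 0 < p → valEnt {⟨p, ⊥⟩} ∅
  | mono (p q : ℚ) (a b : S) : q ≤ p → a ≤ b → valEnt {⟨p, a⟩} {⟨q, b⟩}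

/-- The entailments for covaluations other than the modular ones. -/
inductive covalEnt : Finset (ValGen S) → Finset (ValGen S) → Prop
  | nonneg (p : ℚ) (a : S) : p < 0 → covalEnt {⟨p, a⟩} ∅
  | top (p : ℚ) : 0 < p → covalEnt ∅ {⟨p, ⊤⟩}
  | mono (p q : ℚ) (a b : S) : p ≤ q → a ≤ b → covalEnt {⟨p, a⟩} {⟨q, b⟩}

/-- The extra entailments for probabilistic valuations. -/
inductive probValEnt : Finset (ValGen S) → Finset (ValGen S) → Prop
  | le_one (p : ℚ) (a : S) : 1 < p → probValEnt {⟨p, a⟩} ∅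
  | one_le (p : ℚ) : p < 1 → probValEnt ∅ {⟨p, ⊤⟩}

/-- The extra entailments for probabilistic covaluations. -/
inductive probCovalEnt : Finset (ValGen S) → Finset (ValGen S) → Prop
  | le_one (p : ℚ) (a : S) : 1 < p → probCovalEnt ∅ {⟨p, a⟩}
  | one_le (p : ℚ) : p < 1 → probCovalEnt {⟨p, ⊥⟩} ∅

open Classical in
/-- `⟨p, a⟩, ⟨q, b⟩ ⊢ ⟨r, a ∧ b⟩, ⟨s, a ∨ b⟩` if `p + q = r + s`. -/
inductive disjEnt₁ : Finset (ValGen S) → Finset (ValGen S) → Prop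
  | intro (p q r s : ℚ) (a b : S) : p + q = r + s →
      disjEnt₁ {⟨p, a⟩, ⟨q, b⟩} {⟨r, a ⊓ b⟩, ⟨s, a ⊔ b⟩}

open Classical in
/-- `⟨r, a ∧ b⟩, ⟨s, a ∨ b⟩ ⊢ ⟨p, a⟩, ⟨q, b⟩` if `p + q = r + s`. -/
inductive disjEnt₂ : Finset (ValGen S) → Finset (ValGen S) → Prop
  | intro (p q r s : ℚ) (a b : S) : p + q = r + s →
      disjEnt₂ {⟨r, a ⊓ b⟩, ⟨s, a ⊔ b⟩} {⟨p, a⟩, ⟨q, b⟩}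

/-- The entailment relation of valuations on `Spec S`. -/
def valEntailment : Finset (ValGen S) → Finset (ValGen S) → Prop :=
  generatedEntailment (valEnt S ⊔ disjEnt₁ S ⊔ disjEnt₂ S)

/-- The entailment relation of covaluations on `Spec S`. -/
def covalEntailment : Finset (ValGen S) → Finset (ValGen S) → Prop :=
  generatedEntailment (covalEnt S ⊔ disjEnt₁ S ⊔ disjEnt₂ S)

/-- The entailment relation of probabilistic valuations on `Spec S`. -/
def probValEntailment : Finset (ValGen S) → Finset (ValGen S) → Prop :=
  generatedEntailment (valEnt S ⊔ disjEnt₁ S ⊔ disjEnt₂ S ⊔ probValEnt S)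

/-- The entailment relation of probabilistic covaluations on `Spec S`. -/
def probCovalEntailment : Finset (ValGen S) → Finset (ValGen S) → Prop :=
  generatedEntailment (covalEnt S ⊔ disjEnt₁ S ⊔ disjEnt₂ S ⊔ probCovalEnt S)

/-- The axioms other than the modular law in the geometric theory of valuations on `Spec S`
over the generators `⟨p, a⟩`; those of `roundTheory` are `⟨p, a⟩ ⊢ ⟨q, b⟩` if `q < p` and `a ≺ b`,
and `⟨p, a⟩ ⊢ ⋁ (p < q, b ≺ a) ⟨q, b⟩`. -/
def valBaseTheory : GeometricTheory (ValGen S) :=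
  finitaryTheory (valEnt S) ⊔ roundTheory (valPrec S)

/-- The axioms other than the modular law in the geometric theory of covaluations on `Spec S`
over the generators `⟨p, a⟩`. -/
def covalBaseTheory : GeometricTheory (ValGen S) :=
  finitaryTheory (covalEnt S) ⊔ roundTheory (covalPrec S)

/-- The geometric theory of valuations on `Spec S` over the generators `⟨p, a⟩`. -/
def valTheory : GeometricTheory (ValGen S) :=
  valBaseTheory S ⊔ modularTheory₁ S ⊔ modularTheory₂ S

/-- The geometric theory of covaluations on `Spec S` over the generators `⟨p, a⟩`. -/
def covalTheory : GeometricTheory (ValGen S) :=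
  covalBaseTheory S ⊔ modularTheory₁ S ⊔ modularTheory₂ S

/-- The subset of the generators `⟨q, a⟩` that a map on `Spec S` determines: those with `q` in
the value at the rounded ideal of the elements `b ≺ a`. -/
def modelOf {S : Type u} [DistribLattice S] [BoundedOrder S] [StrongProximityLattice S]
    (μ : Spec S → Set ℚ) : Set (ValGen S) :=
  {g | g.rat ∈ μ (RoundedIdeal.down g.elt)}

end

end PointFree

open PointFree

/-! All four cases are instances of one. A covaluation `ν` is replaced by `μ = -ν`, which is again
increasing, so a generator is read as `p < μ a` after applying an additive automorphism `n` of `ℚ`: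
the identity for valuations, negation for covaluations. The normalisations are two sets of
constants: `lo` prescribes the value at the bottom, `hi` the value at the top. The cases are `({0},
∅)`, `(∅, {0})`, `({0}, {1})` and `({-1}, {0})`; only `lo ∪ hi` being nonempty matters.

The geometric modular law asks for a splitting `p' + q' = p + q`, whereas the finitary one offers a
choice between two conclusions for each splitting. The former implies the latter because one of two
summands must be large enough. Conversely, roundedness leaves a slack `ε`; one walks along an
arithmetic progression of stride `ε`, applying the finitary law at each point, and the place where
the choice switches yields a splitting. A bound on one side suffices to start and stop the walk
(`SumDisj.sumLE`).

Continuity of a generated entailment relation can be checked on its generators, since the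
entailments that interpolate are themselves closed under weakening and cut
(`IsEntailmentRelation.exists_lowerExt`). For the generators one interpolates in `ℚ` and in `S` at
once; the join and meet conditions on `≺` are what the two modular axioms need.

For the presentations, a family over `S` extends uniquely to `Spec S` by taking joins over rounded
ideals (`IsValuationFamily.existsUnique`). Since this holds with values in any frame, the theories
over `S` and over `Spec S` have the same universal property (`IsPresentedBy.of_restrict`), and the
frame of truth values gives the bijection between valuations and models (`bijOn_modelOf`).

A locale presented by a strong continuous entailment relation is a retract of the coherent locale of
the underlying finitary theory, hence stably compact (`IsStrongContEnt.isStablyCompact`). A general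
stably compact `X` is a retract of the spectrum of its own frame
(`IsStablyCompact.exists_retraction`), and the constructions are functorial, so retracts are
preserved (`isStablyCompact_of_spec`). -/

namespace PointFree

open StrongProximityLattice

/-! ### Stably compact locales and their retracts -/

section StablyCompact

variable {L : Type u}

theorem WayBelow.le [CompleteLattice L] {a b : L} (h : WayBelow a b) : a ≤ b := by
  obtain ⟨d, rfl, hd⟩ := h {b} (Set.singleton_nonempty b) (directedOn_singleton _) (by simp)
  exact hd

theorem WayBelow.mono [CompleteLattice L] {a b c d : L} (hab : a ≤ b) (h : WayBelow b c)
    (hcd : c ≤ d) : WayBelow a d := fun D hD hdir hle =>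
  let ⟨e, he, hbe⟩ := h D hD hdir (hcd.trans hle)
  ⟨e, he, hab.trans hbe⟩

theorem bot_wayBelow [CompleteLattice L] (a : L) : WayBelow ⊥ a := fun _ hD _ _ =>
  let ⟨d, hd⟩ := hD
  ⟨d, hd, bot_le⟩

theorem WayBelow.sup [CompleteLattice L] {a b c : L} (ha : WayBelow a c) (hb : WayBelow b c) :
    WayBelow (a ⊔ b) c := fun D hD hdir hle => by
  obtain ⟨d, hd, had⟩ := ha D hD hdir hle
  obtain ⟨e, he, hbe⟩ := hb D hD hdir hle
  obtain ⟨f, hf, hdf, hef⟩ := hdir d hd e he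
  exact ⟨f, hf, sup_le (had.trans hdf) (hbe.trans hef)⟩

/-- An element way below a join is below a finite subjoin. -/
theorem WayBelow.exists_finset [CompleteLattice L] {a : L} {s : Set L} (h : WayBelow a (sSup s)) :
    ∃ F : Finset L, (F : Set L) ⊆ s ∧ a ≤ F.sup id := by
  classical
  obtain ⟨_, ⟨F, hF, rfl⟩, ha⟩ := h {x | ∃ F : Finset L, (F : Set L) ⊆ s ∧ F.sup id = x}
    ⟨⊥, ∅, by simp⟩ (by
      rintro _ ⟨F, hF, rfl⟩ _ ⟨H, hH, rfl⟩
      refine ⟨_, ⟨F ∪ H, by simp [hF, hH], rfl⟩, ?_, ?_⟩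
      · exact Finset.sup_mono Finset.subset_union_left
      · exact Finset.sup_mono Finset.subset_union_right)
    (sSup_le fun x hx => le_sSup ⟨{x}, by simpa using hx, by simp⟩)
  exact ⟨F, hF, ha⟩

/-- A frame that is generated by compact elements that are closed under finite meets is stably
compact. -/
theorem isStablyCompact_of_compact_generators [Order.Frame L] (K : Set L)
    (hK : ∀ k ∈ K, WayBelow k k) (htop : ⊤ ∈ K) (hinf : ∀ k ∈ K, ∀ l ∈ K, k ⊓ l ∈ K)
    (hgen : ∀ x : L, x ≤ sSup {k ∈ K | k ≤ x}) : IsStablyCompact L where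
  compact := hK _ htop
  continuous x := by
    refine le_antisymm ((hgen x).trans (sSup_le_sSup ?_)) (sSup_le fun a ha => ha.le)
    exact fun k hk => (hK k hk.1).mono le_rfl hk.2
  stable a b c hb hc := by
    obtain ⟨F, hF, haF⟩ := (hb.mono le_rfl (hgen b)).exists_finset
    obtain ⟨H, hH, haH⟩ := (hc.mono le_rfl (hgen c)).exists_finset
    refine WayBelow.mono (le_inf haF haH) ?_ le_rfl
    -- By distributivity the meet of two finite joins of compact elements is a finite join of binary
    -- meets, which are compact by hypothesis.
    rw [Finset.sup_inf_sup]
    refine Finset.sup_induction (p := fun x => WayBelow x (b ⊓ c)) (bot_wayBelow _)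
      (fun _ h _ k => h.sup k) fun x hx => ?_
    rw [Finset.mem_product] at hx
    have h1 := hF hx.1
    have h2 := hH hx.2
    exact (hK _ (hinf _ h1.1 _ h2.1)).mono le_rfl (inf_le_inf h1.2 h2.2)

/-- A retract of a stably compact locale is stably compact. -/
theorem IsStablyCompact.of_retract {M : Type v} [Order.Frame L] [Order.Frame M]
    (hM : IsStablyCompact M) (s : FrameHom L M) (r : FrameHom M L) (hrs : ∀ x, r (s x) = x) :
    IsStablyCompact L := by
  have key : ∀ {a : M} {x : L}, WayBelow a (s x) → WayBelow (r a) x := by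
    intro a x h D hD hdir hle
    obtain ⟨_, ⟨d, hd, rfl⟩, had⟩ := h (s '' D) (hD.image s)
      (by
        rintro _ ⟨d, hd, rfl⟩ _ ⟨e, he, rfl⟩
        obtain ⟨f, hf, hdf, hef⟩ := hdir d hd e he
        exact ⟨_, ⟨f, hf, rfl⟩, OrderHomClass.mono s hdf, OrderHomClass.mono s hef⟩)
      (by rw [← map_sSup]; exact OrderHomClass.mono s hle)
    exact ⟨d, hd, (OrderHomClass.mono r had).trans_eq (hrs d)⟩
  have approx : ∀ x : L, x = sSup (r '' {a | WayBelow a (s x)}) := fun x => by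
    rw [← map_sSup, ← hM.continuous, hrs]
  -- The images `r b` with `b` way below `s x` form a directed set with join `x`. So the way-below
  -- relation of the retract is controlled from above by that of `M`, and stability can be pulled
  -- back.
  have below : ∀ {a x : L}, WayBelow a x → ∃ b, WayBelow b (s x) ∧ a ≤ r b := by
    intro a x h
    obtain ⟨_, ⟨b, hb, rfl⟩, hab⟩ := h (r '' {a | WayBelow a (s x)})
      ⟨_, ⊥, bot_wayBelow _, rfl⟩
      (by
        rintro _ ⟨d, hd, rfl⟩ _ ⟨e, he, rfl⟩
        exact ⟨_, ⟨d ⊔ e, WayBelow.sup hd he, rfl⟩, OrderHomClass.mono r le_sup_left,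
          OrderHomClass.mono r le_sup_right⟩) (approx x).le
    exact ⟨b, hb, hab⟩
  refine ⟨?_, fun x => ?_, fun a b c hb hc => ?_⟩
  · have := key (a := ⊤) (x := ⊤) (by rw [map_top]; exact hM.compact)
    rwa [map_top] at this
  · refine le_antisymm ?_ (sSup_le fun a ha => ha.le)
    conv_lhs => rw [approx x]
    refine sSup_le_sSup ?_
    rintro _ ⟨a, ha, rfl⟩
    exact key ha
  · obtain ⟨d, hd, had⟩ := below hb
    obtain ⟨e, he, hae⟩ := below hc
    refine WayBelow.mono (le_inf had hae) ?_ le_rfl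
    rw [← map_inf]
    refine key ?_
    rw [map_inf]
    exact hM.stable _ _ _ (hd.mono inf_le_left le_rfl) (he.mono inf_le_right le_rfl)

end StablyCompact

/-! ### Stably compact locales as retracts of spectra -/

/-- The order of a distributive lattice is a proximity. -/
@[reducible]
def orderProximity (S : Type u) [DistribLattice S] [BoundedOrder S] : StrongProximityLattice S where
  prec a b := a ≤ b
  prec_of_le_of_prec := le_trans
  bot_prec _ := bot_le
  sup_prec := sup_le
  prec_of_prec_of_le := le_trans
  prec_top _ := le_top
  prec_inf := le_inf
  prec_iff_exists a _ := ⟨fun h => ⟨a, le_rfl, h⟩, fun ⟨_, h, k⟩ => h.trans k⟩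
  eq_bot_of_prec_bot := le_bot_iff.1
  exists_of_prec_sup {_ b c} h := ⟨b, c, h, le_rfl, le_rfl⟩
  eq_top_of_top_prec := top_le_iff.1
  exists_of_inf_prec {_ b c} h := ⟨b, c, le_rfl, le_rfl, h⟩

/-- A stably compact locale is a retract of the locale of ideals of its frame. -/
theorem IsStablyCompact.exists_retraction {X : Type u} [Order.Frame X] (hX : IsStablyCompact X) :
    let _ := orderProximity X
    ∃ (s : FrameHom X (Spec X)) (r : FrameHom (Spec X) X), ∀ x, r (s x) = x := by
  let _ := orderProximity X
  let s₀ : X → Spec X := fun x =>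
    { carrier := {a | WayBelow a x}
      lower := fun h k => WayBelow.mono h k le_rfl
      bot_mem := bot_wayBelow x
      sup_mem := WayBelow.sup
      rounded := fun a => ⟨fun h => ⟨a, le_rfl, h⟩, fun ⟨_, h, k⟩ => WayBelow.mono h k le_rfl⟩ }
  have hmono : Monotone s₀ := fun x y h a ha => WayBelow.mono le_rfl ha h
  have rmono : ∀ I J : Spec X, I ≤ J → sSup I.carrier ≤ sSup J.carrier := fun I J h =>
    sSup_le_sSup h
  refine ⟨{ toFun := s₀, map_inf' := fun x y => ?_, map_top' := ?_, map_sSup' := fun t => ?_ },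
    { toFun := fun I => sSup I.carrier, map_inf' := fun I J => ?_, map_top' := ?_
      map_sSup' := fun t => ?_ }, fun x => (hX.continuous x).symm⟩
  -- The elements way below `x` depend on `x` through a frame homomorphism precisely because of
  -- stability (binary meets), compactness (top) and continuity (joins).
  · refine le_antisymm (le_inf (hmono inf_le_left) (hmono inf_le_right)) ?_
    exact fun a ha => hX.stable _ _ _ ha.1 ha.2
  · exact top_le_iff.1 fun a _ => hX.compact.mono le_top le_rfl
  · refine le_antisymm (fun a ha => ?_) (sSup_le ?_)
    · have h : sSup t ≤ sSup {b | ∃ x ∈ t, WayBelow b x} := sSup_le fun x hx => by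
        rw [hX.continuous x]
        exact sSup_le_sSup fun b hb => ⟨x, hx, hb⟩
      obtain ⟨F, hF, haF⟩ := (WayBelow.mono le_rfl ha h).exists_finset
      refine ⟨F, fun b hb => ?_, haF⟩
      obtain ⟨x, hx, hbx⟩ := hF hb
      exact ⟨_, ⟨x, hx, rfl⟩, hbx⟩
    · rintro _ ⟨x, hx, rfl⟩
      exact hmono (le_sSup hx)
  · refine le_antisymm (le_inf (rmono _ _ inf_le_left) (rmono _ _ inf_le_right)) ?_
    rw [sSup_inf_sSup]
    refine iSup₂_le fun a ha => le_sSup ⟨I.lower inf_le_left ha.1, J.lower inf_le_right ha.2⟩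
  · refine top_le_iff.1 (le_sSup ?_)
    have h : RoundedIdeal.down (⊤ : X) ≤ ⊤ := le_top
    exact h (le_refl (⊤ : X))
  · refine le_antisymm (sSup_le ?_) (sSup_le ?_)
    · rintro a ⟨F, hF, haF⟩
      refine haF.trans (Finset.sup_le fun b hb => ?_)
      obtain ⟨I, hI, hbI⟩ := hF b hb
      exact (le_sSup hbI).trans (le_sSup ⟨I, hI, rfl⟩)
    · rintro _ ⟨I, hI, rfl⟩
      exact rmono _ _ (le_sSup hI)

/-! ### Interpretations, models and coherent locales -/

section Theories

variable {G : Type u}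

theorem isInterpretation_sup {T T' : GeometricTheory G} {L : Type v} [Order.Frame L] {f : G → L} :
    IsInterpretation (T ⊔ T') f ↔ IsInterpretation T f ∧ IsInterpretation T' f :=
  ⟨fun h => ⟨fun A 𝓑 hT => h A 𝓑 (Or.inl hT), fun A 𝓑 hT => h A 𝓑 (Or.inr hT)⟩,
    fun h A 𝓑 hT => hT.elim (h.1 A 𝓑) (h.2 A 𝓑)⟩

theorem isInterpretation_finitaryTheory {E : Finset G → Finset G → Prop} {L : Type v}
    [Order.Frame L] {f : G → L} :
    IsInterpretation (finitaryTheory E) f ↔ ∀ A B, E A B → A.inf f ≤ B.sup f := by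
  have key : ∀ B : Finset G, ⨆ C ∈ {C : Finset G | ∃ b ∈ B, C = {b}}, C.inf f = B.sup f := fun B => by
    refine le_antisymm (iSup₂_le ?_) (Finset.sup_le fun b hb => ?_)
    · rintro _ ⟨b, hb, rfl⟩
      simpa using Finset.le_sup hb
    · exact le_iSup₂_of_le {b} ⟨b, hb, rfl⟩ (by simp)
  refine ⟨fun h A B hE => (h _ _ ⟨A, B, hE⟩).trans_eq (key B), ?_⟩
  rintro h A _ ⟨_, B, hE⟩
  exact (h A B hE).trans_eq (key B).symm

theorem isInterpretation_roundTheory {r : G → G → Prop} {L : Type v} [Order.Frame L] {f : G → L} :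
    IsInterpretation (roundTheory r) f ↔
      (∀ a b, r a b → f a ≤ f b) ∧ ∀ a, f a ≤ ⨆ b, ⨆ _ : r b a, f b := by
  constructor
  · intro h
    refine ⟨fun a b hr => by simpa using h _ _ (.prec a b hr), fun a => ?_⟩
    have := h _ _ (.round a)
    rw [Finset.inf_singleton] at this
    refine this.trans (iSup₂_le ?_)
    rintro _ ⟨b, hb, rfl⟩
    rw [Finset.inf_singleton]
    exact le_iSup₂_of_le b hb le_rfl
  · rintro ⟨h, k⟩ _ _ (⟨a, b, hr⟩ | a)
    · simpa using h a b hr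
    · rw [Finset.inf_singleton]
      refine (k a).trans (iSup₂_le fun b hb => le_iSup₂_of_le {b} ⟨b, hb, rfl⟩ (by simp))

/-- The models of a geometric theory are its interpretations in the frame of truth values. -/
theorem isModel_iff_isInterpretation {T : GeometricTheory G} {α : Set G} :
    IsModel T α ↔ IsInterpretation T fun g => g ∈ α := by
  have key : ∀ A : Finset G, A.inf (fun g => g ∈ α) ↔ (A : Set G) ⊆ α := fun A => by
    classical
    induction A using Finset.induction_on with
    | empty => simp
    | insert a s _ ih =>
      rw [Finset.inf_insert, Finset.coe_insert, Set.insert_subset_iff, ← ih]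
      rfl
  refine forall₃_congr fun A 𝓑 _ => ?_
  change _ ↔ (_ → _)
  rw [key]
  simp [key]

/-- The locale presented by a finitary theory is coherent, hence stably compact. -/
theorem isStablyCompact_finitaryTheory (E : Finset G → Finset G → Prop) :
    IsStablyCompact (Space (finitaryTheory E)) := by
  classical
  set T := finitaryTheory E
  have gi := (theorySublocale T).giRestrict
  have e : ∀ A : Finset G, A.inf (Space.gen T) = (theorySublocale T).restrict (A.inf freeGen) :=
    fun A => (map_finset_inf (theorySublocale T).restrict A freeGen).symm
  have hle : ∀ (A : Finset G) (U : Space T),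
      A.inf (Space.gen T) ≤ U ↔ OrderDual.toDual A ∈ (U : FreeFrame G) := fun A U => by
    rw [e]
    refine (gi.gc _ _).trans ⟨fun h => h ((mem_inf_freeGen A A).2 subset_rfl), fun h B hB => ?_⟩
    exact (U : FreeFrame G).lower ((mem_inf_freeGen A (OrderDual.ofDual B)).1 hB) h
  refine isStablyCompact_of_compact_generators (Set.range fun A : Finset G => A.inf (Space.gen T))
    ?_ ⟨∅, rfl⟩ ?_ fun U => ?_
  · rintro _ ⟨A, rfl⟩ D hD hdir hA
    -- Finitarity makes the directed union of closed lower sets closed, so directed joins in the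
    -- quotient are unions and finite meets of generators are compact.
    have hmem : (⨆ d ∈ D, (d : FreeFrame G)) ∈ theorySublocale T := by
      rintro A' _ ⟨_, B, hE⟩ W hW Y ⟨hAY, hYW⟩
      have hB : ∀ b ∈ B, ∃ d ∈ D, OrderDual.toDual (insert b (OrderDual.ofDual Y)) ∈
          (d : FreeFrame G) := fun b hb => by
        have : OrderDual.toDual (insert b (OrderDual.ofDual Y)) ∈ ⨆ d ∈ D, (d : FreeFrame G) := by
          refine hW ⟨?_, W.lower (a := Y) (Finset.subset_insert _ _) hYW⟩
          have hb' : ({b} : Finset G).inf freeGen ≤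
              ⨆ C ∈ {C : Finset G | ∃ b ∈ B, C = {b}}, C.inf freeGen :=
            le_iSup₂_of_le {b} ⟨b, hb, rfl⟩ le_rfl
          exact hb' ((mem_inf_freeGen _ _).2 (by simp))
        simpa using this
      -- The conclusion of the axiom has finitely many disjuncts, so by directedness a single member
      -- of `D` handles all of them.
      obtain ⟨d, hd, hdB⟩ : ∃ d ∈ D, ∀ b ∈ B, OrderDual.toDual (insert b (OrderDual.ofDual Y)) ∈
          (d : FreeFrame G) := by
        clear hE hW
        induction B using Finset.induction_on with
        | empty => obtain ⟨d, hd⟩ := hD; exact ⟨d, hd, by simp⟩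
        | insert b B _ ih =>
          obtain ⟨d, hd, h⟩ := ih fun c hc => hB c (Finset.mem_insert_of_mem hc)
          obtain ⟨d', hd', h'⟩ := hB b (Finset.mem_insert_self _ _)
          obtain ⟨c, hc, hdc, hdc'⟩ := hdir d hd d' hd'
          refine ⟨c, hc, fun x hx => ?_⟩
          obtain rfl | hx := Finset.mem_insert.1 hx
          · exact hdc' h'
          · exact hdc (h x hx)
      -- The closure condition of `d` is applied with `W` the basic element given by `Y` itself,
      -- since the original `W` need not be covered within `d`.
      have := d.2 A' _ ⟨A', B, hE⟩ ((OrderDual.ofDual Y).inf freeGen) (by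
        rintro Z ⟨hZ, hYZ⟩
        simp only [Set.mem_ofPred_eq, SetLike.mem_coe, LowerSet.mem_iSup_iff] at hZ
        obtain ⟨_, ⟨b, hb, rfl⟩, hbZ⟩ := hZ
        refine (d : FreeFrame G).lower (a := OrderDual.toDual (insert b (OrderDual.ofDual Y)))
          ?_ (hdB b hb)
        have h1 := (mem_inf_freeGen _ (OrderDual.ofDual Z)).1 hYZ
        have h2 := (mem_inf_freeGen _ (OrderDual.ofDual Z)).1 hbZ
        exact Finset.insert_subset (h2 (Finset.mem_singleton_self b)) h1)
      have hY := this ⟨hAY, (mem_inf_freeGen _ (OrderDual.ofDual Y)).2 subset_rfl⟩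
      have hdle : (d : FreeFrame G) ≤ ⨆ d ∈ D, (d : FreeFrame G) := le_iSup₂_of_le d hd le_rfl
      exact hdle hY
    have h1 : sSup D ≤ (⟨_, hmem⟩ : Space T) := sSup_le fun d hd =>
      show (d : FreeFrame G) ≤ ⨆ d ∈ D, (d : FreeFrame G) from le_iSup₂_of_le d hd le_rfl
    have h2 := (hle A _).1 (hA.trans h1)
    have h3 : ∃ d ∈ D, OrderDual.toDual A ∈ (d : FreeFrame G) := by simpa using h2
    obtain ⟨d, hd, h⟩ := h3
    exact ⟨d, hd, (hle A d).2 h⟩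
  · rintro _ ⟨A, rfl⟩ _ ⟨B, rfl⟩
    exact ⟨A ∪ B, Finset.inf_union⟩
  · intro A hA
    have h := (hle (OrderDual.ofDual A) U).2 hA
    refine (hle (OrderDual.ofDual A) _).1 (le_sSup ⟨⟨_, rfl⟩, h⟩)

end Theories

/-! ### Generated entailment relations and their continuity -/

section Entailment

variable {G : Type u} {E E₀ : Finset G → Finset G → Prop} {r : G → G → Prop}

theorem IsEntailmentRelation.weaken (hE : IsEntailmentRelation E) {A A' B B' : Finset G}
    (h : E A B) (hA : A ⊆ A') (hB : B ⊆ B') : E A' B' := by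
  classical
  have := hE.mono A A' B B' h
  convert this using 1
  · exact (Finset.union_eq_left.2 hA).symm
  · exact (Finset.union_eq_right.2 hB).symm

-- The rules are symmetric in the two sides. This reduces interpolation on the left to interpolation
-- on the right.
open Classical in
theorem IsEntailmentRelation.flip (hE : IsEntailmentRelation E) : IsEntailmentRelation (flip E) where
  refl := hE.refl
  mono _ _ _ _ h := hE.weaken h Finset.subset_union_left Finset.subset_union_right
  cut A B a h k := hE.cut B A a k h

open Classical in
theorem IsEntailmentRelation.cut_finset (hE : IsEntailmentRelation E) {A B C : Finset G}
    (h : E A (B ∪ C)) (hC : ∀ c ∈ C, E (insert c A) B) : E A B := by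
  induction C using Finset.induction_on with
  | empty => simpa using h
  | insert c C _ ih =>
    refine ih (hE.cut A _ c (by simpa using h) ?_) fun d hd => hC d (Finset.mem_insert_of_mem hd)
    exact hE.weaken (hC c (Finset.mem_insert_self _ _)) subset_rfl Finset.subset_union_left

theorem isEntailmentRelation_generated (E₀ : Finset G → Finset G → Prop) :
    IsEntailmentRelation (generatedEntailment E₀) where
  refl a _ hE _ := hE.refl a
  mono A A' B B' h E hE h₀ := hE.mono A A' B B' (h E hE h₀)
  cut A B a h k E hE h₀ := hE.cut A B a (h E hE h₀) (k E hE h₀)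

theorem generatedEntailment_of {A B : Finset G} (h : E₀ A B) : generatedEntailment E₀ A B :=
  fun _ _ h₀ => h₀ A B h

/-- The half of the continuity of a generated entailment relation that interpolates on the right
need only be checked on the generating entailments. -/
theorem IsEntailmentRelation.exists_lowerExt (hE : IsEntailmentRelation E)
    (hmin : ∀ E' : Finset G → Finset G → Prop, IsEntailmentRelation E' →
      (∀ C D, E₀ C D → E' C D) → ∀ C D, E C D → E' C D)
    (h₀ : ∀ C D, E₀ C D → ∀ A, UpperExt r A C → ∃ B, E A B ∧ LowerExt r B D)
    {A C D : Finset G} (hA : UpperExt r A C) (h : E C D) : ∃ B, E A B ∧ LowerExt r B D := by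
  classical
  -- Minimality is applied to the relation "interpolates on the right"; only its closure under cut
  -- takes work.
  refine hmin (fun C D => ∀ A, UpperExt r A C → ∃ B, E A B ∧ LowerExt r B D) ⟨?_, ?_, ?_⟩ h₀ C D h
    A hA
  · intro a A hA
    obtain ⟨b, hb, hba⟩ := hA a (Finset.mem_singleton_self a)
    refine ⟨{b}, hE.weaken (hE.refl b) (by simpa using hb) subset_rfl, fun c hc => ?_⟩
    exact ⟨a, Finset.mem_singleton_self a, by rwa [Finset.mem_singleton.1 hc]⟩
  · intro C C' D D' h A hA
    obtain ⟨B, hB, hBD⟩ := h A fun b hb => hA b (Finset.mem_union_right _ hb)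
    refine ⟨B, hB, fun b hb => ?_⟩
    obtain ⟨d, hd, hbd⟩ := hBD b hb
    exact ⟨d, Finset.mem_union_left _ hd, hbd⟩
  · intro C D c h k A hA
    obtain ⟨B, hB, hBD⟩ := h A hA
    -- Each `b` below the cut element `c` can replace `c` in the second premise. The value `∅` for
    -- other `b` is a dummy that makes the choice total.
    have hB' : ∀ b : G, ∃ B', r b c → E (insert b A) B' ∧ LowerExt r B' D := fun b => by
      by_cases hb : r b c
      · obtain ⟨B', hB'⟩ := k (insert b A) fun x hx => by
          obtain rfl | hx := Finset.mem_insert.1 hx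
          · exact ⟨b, Finset.mem_insert_self _ _, hb⟩
          · obtain ⟨a, ha, hax⟩ := hA x hx
            exact ⟨a, Finset.mem_insert_of_mem ha, hax⟩
        exact ⟨B', fun _ => hB'⟩
      · exact ⟨∅, fun h => (hb h).elim⟩
    choose B' hB' using hB'
    -- `B₁` already lies below `D`; the elements of `B₂` lie below `c` and are cut away, each at the
    -- price of its own interpolant `B' b`.
    set B₁ := B.filter fun b => ∃ d ∈ D, r b d
    set B₂ := B.filter fun b => r b c
    refine ⟨B₁ ∪ B₂.biUnion B', hE.cut_finset (C := B₂) (hE.weaken hB subset_rfl ?_) ?_, ?_⟩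
    · intro b hb
      obtain ⟨d, hd, hbd⟩ := hBD b hb
      obtain rfl | hd := Finset.mem_insert.1 hd
      · exact Finset.mem_union_right _ (Finset.mem_filter.2 ⟨hb, hbd⟩)
      · exact Finset.mem_union_left _
          (Finset.mem_union_left _ (Finset.mem_filter.2 ⟨hb, d, hd, hbd⟩))
    · intro b hb
      refine hE.weaken (hB' b (Finset.mem_filter.1 hb).2).1 subset_rfl ?_
      exact (Finset.subset_biUnion_of_mem B' hb).trans Finset.subset_union_right
    · intro b hb
      obtain hb | hb := Finset.mem_union.1 hb
      · exact (Finset.mem_filter.1 hb).2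
      · obtain ⟨x, hx, hbx⟩ := Finset.mem_biUnion.1 hb
        exact (hB' x (Finset.mem_filter.1 hx).2).2 b hbx

/-- An entailment relation is strong continuous if the generating entailments are. -/
theorem isStrongContEnt_generated (hr : ∀ a c, r a c ↔ ∃ b, r a b ∧ r b c)
    (hu : ∀ C D, E₀ C D → ∀ A, UpperExt r A C →
      ∃ B, generatedEntailment E₀ A B ∧ LowerExt r B D)
    (hl : ∀ C D, E₀ C D → ∀ B, LowerExt r D B →
      ∃ A, UpperExt r C A ∧ generatedEntailment E₀ A B) :
    IsStrongContEnt (generatedEntailment E₀) r where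
  entailment := isEntailmentRelation_generated E₀
  idempotent := hr
  continuous A B := by
    constructor
    · rintro ⟨C, hC, h⟩
      exact (isEntailmentRelation_generated E₀).exists_lowerExt
        (fun E' hE' h₀ C D h => h E' hE' h₀) hu hC h
    · rintro ⟨C, h, hC⟩
      -- Reversing both the entailments and `r` interchanges the lower and the upper extension.
      obtain ⟨D, hD, hCD⟩ := (isEntailmentRelation_generated E₀).flip.exists_lowerExt
        (E₀ := flip E₀) (r := flip r)
        (fun E' hE' h₀ C D h => h (flip E') hE'.flip fun C D h => h₀ D C h)
        (fun C D h A hA => let ⟨B, hB, hB'⟩ := hl D C h A hA; ⟨B, hB', hB⟩) (A := B) hC h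
      exact ⟨D, hCD, hD⟩

/-- In any frame the relation `A.inf f ≤ B.sup f` is an entailment relation: cut is the distributive
law. Hence generation adds no condition on interpretations. -/
theorem isInterpretation_generatedEntailment {L : Type v} [Order.Frame L] {f : G → L} :
    IsInterpretation (finitaryTheory (generatedEntailment E₀)) f ↔
      IsInterpretation (finitaryTheory E₀) f := by
  classical
  simp only [isInterpretation_finitaryTheory]
  refine ⟨fun h A B hE => h A B (generatedEntailment_of hE), fun h A B hE => ?_⟩
  refine hE (fun A B => A.inf f ≤ B.sup f) ⟨by simp, fun A A' B B' h => ?_, fun A B a h k => ?_⟩ h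
  · exact (Finset.inf_mono Finset.subset_union_right).trans
      (h.trans (Finset.sup_mono Finset.subset_union_left))
  · rw [Finset.sup_insert] at h
    rw [Finset.inf_insert] at k
    calc A.inf f ≤ (f a ⊔ B.sup f) ⊓ A.inf f := le_inf h le_rfl
      _ ≤ B.sup f := by
        rw [inf_sup_right]
        exact sup_le k inf_le_left

/-- A locale that is presented by a strong continuous entailment relation is a retract of the
coherent locale presented by the entailment relation. -/
theorem IsStrongContEnt.isStablyCompact (h : IsStrongContEnt E r) {F : Type u} [Order.Frame F]
    {i : G → F} (hi : IsPresentedBy.{u, u, u} (contEntTheory E r) i) : IsStablyCompact F := by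
  classical
  set γ := Space.gen (finitaryTheory E)
  have hγ := Space.isPresentedBy.{u, u} (finitaryTheory E)
  -- The section replaces each generator by its rounded version, which satisfies the round axioms by
  -- idempotence of `r` and the finitary ones by continuity of `E`.
  set f : G → Space (finitaryTheory E) := fun g => ⨆ b, ⨆ _ : r b g, γ b with hf
  have hinf : ∀ A : Finset G, A.inf f ≤ ⨆ A', ⨆ _ : UpperExt r A' A, A'.inf γ := fun A => by
    induction A using Finset.induction_on with
    | empty => exact le_iSup₂_of_le ∅ (fun b hb => by simp at hb) (by simp)
    | insert a A _ ih =>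
      rw [Finset.inf_insert]
      refine (inf_le_inf_left _ ih).trans ?_
      rw [iSup₂_inf_eq]
      refine iSup₂_le fun b hb => ?_
      rw [inf_iSup₂_eq]
      refine iSup₂_le fun A' hA' => ?_
      rw [← Finset.inf_insert]
      refine le_iSup₂_of_le (insert b A') (fun x hx => ?_) le_rfl
      obtain rfl | hx := Finset.mem_insert.1 hx
      · exact ⟨b, Finset.mem_insert_self _ _, hb⟩
      · obtain ⟨y, hy, hyx⟩ := hA' x hx
        exact ⟨y, Finset.mem_insert_of_mem hy, hyx⟩
  have hfi : IsInterpretation (contEntTheory E r) f := by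
    refine isInterpretation_sup.2 ⟨isInterpretation_finitaryTheory.2 fun A B hAB => ?_,
      isInterpretation_roundTheory.2 ⟨fun a b hab => ?_, fun a => ?_⟩⟩
    · refine (hinf A).trans (iSup₂_le fun A' hA' => ?_)
      obtain ⟨B', hB', hBB⟩ := (h.continuous A' B).1 ⟨A, hA', hAB⟩
      refine (isInterpretation_finitaryTheory.1 hγ.1 A' B' hB').trans (Finset.sup_le fun b hb => ?_)
      obtain ⟨c, hc, hbc⟩ := hBB b hb
      exact (le_iSup₂_of_le (f := fun b (_ : r b c) => γ b) b hbc le_rfl).trans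
        (Finset.le_sup (f := f) hc)
    · exact iSup₂_le fun c hc => le_iSup₂_of_le c ((h.idempotent c b).2 ⟨a, hc, hab⟩) le_rfl
    · refine iSup₂_le fun c hc => ?_
      obtain ⟨b, hcb, hba⟩ := (h.idempotent c a).1 hc
      exact le_iSup₂_of_le b hba (le_iSup₂_of_le c hcb le_rfl)
  obtain ⟨s, hs, -⟩ := hi.2 _ f hfi
  have hifin := isInterpretation_sup.1 hi.1
  obtain ⟨t, ht, -⟩ := hγ.2 F i hifin.1
  refine (isStablyCompact_finitaryTheory E).of_retract s t fun x => ?_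
  have e : t.comp s = FrameHom.id F := by
    refine (hi.2 F i hi.1).unique (fun g => ?_) fun g => rfl
    have hround := isInterpretation_roundTheory.1 hifin.2
    change t (s (i g)) = i g
    rw [hs, hf]
    -- The round trip sends `i g` to the join of all `i b` with `r b g`, which is `i g` by the round
    -- axioms.
    simp only [map_iSup₂]
    exact le_antisymm (iSup₂_le fun b hb => (ht b).trans_le (hround.1 b g hb))
      ((hround.2 g).trans (iSup₂_mono fun b _ => (ht b).ge))
  exact DFunLike.congr_fun e x

/-- If the interpretations of `T` are exactly the restrictions along `j` of those of `T'`, and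
these are determined by their restrictions, then `T` presents the same locale as `T'`. -/
theorem IsPresentedBy.of_restrict {G' : Type v} {T : GeometricTheory G} {T' : GeometricTheory G'}
    {F : Type v} [Order.Frame F] {i : G' → F} (hi : IsPresentedBy.{v, v, w} T' i) (j : G → G')
    (h₁ : IsInterpretation T fun g => i (j g))
    (h₂ : ∀ (L : Type w) [Order.Frame L] (f : G → L), IsInterpretation T f →
      ∃! f' : G' → L, IsInterpretation T' f' ∧ ∀ g, f' (j g) = f g) :
    IsPresentedBy.{u, v, w} T fun g => i (j g) := by
  refine ⟨h₁, fun L _ f hf => ?_⟩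
  obtain ⟨f', ⟨hf', hj⟩, huniq⟩ := h₂ L f hf
  obtain ⟨k, hk, hkuniq⟩ := hi.2 L f' hf'
  refine ⟨k, fun g => (hk _).trans (hj g), fun l hl => hkuniq l fun g => ?_⟩
  -- A competing homomorphism `l` also gives an interpretation of `T'` that restricts to `f`, so it
  -- agrees with `f'` on all generators of `T'`.
  refine congrFun (huniq (fun g => l (i g)) ⟨fun A 𝓑 hT => ?_, hl⟩) g
  have := OrderHomClass.mono l (hi.1 A 𝓑 hT)
  simpa only [map_iSup₂, map_finset_inf] using this

end Entailment

/-! ### Frame-valued families over rationals and lattice elements -/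

section Curried

variable {S : Type u} {M : Type v}

/-- Antitone in the rational, monotone in the lattice element, with least value `c` for `c ∈ lo` and
largest value `c` for `c ∈ hi`. Here `f p a` is the truth value of `p < μ a`. -/
structure IsBoundedFamily [Lattice S] [BoundedOrder S] [Order.Frame M] (lo hi : Set ℚ)
    (f : ℚ → S → M) : Prop where
  mono : ∀ {p q : ℚ} {a b : S}, q ≤ p → a ≤ b → f p a ≤ f q b
  lo_top : ∀ c ∈ lo, ∀ p < c, ∀ a, f p a = ⊤
  lo_bot : ∀ c ∈ lo, ∀ p, c < p → f p ⊥ = ⊥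
  hi_top : ∀ c ∈ hi, ∀ p < c, f p ⊤ = ⊤
  hi_bot : ∀ c ∈ hi, ∀ p, c < p → ∀ a, f p a = ⊥

/-- Roundedness with respect to the proximity. -/
structure IsProximalFamily [DistribLattice S] [BoundedOrder S] [StrongProximityLattice S]
    [Order.Frame M] (f : ℚ → S → M) : Prop where
  prec : ∀ {p q : ℚ} {a b : S}, q < p → a ≺ b → f p a ≤ f q b
  round : ∀ p a, f p a ≤ ⨆ q, ⨆ b, ⨆ _ : p < q ∧ b ≺ a, f q b

/-- Roundedness in the rational and Scott continuity. -/
structure IsScottFamily [Order.Frame S] [Order.Frame M] (f : ℚ → S → M) : Prop where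
  round : ∀ p x, f p x ≤ ⨆ q, ⨆ _ : p < q, f q x
  scott : ∀ (p : ℚ) (D : Set S), D.Nonempty → DirectedOn (· ≤ ·) D →
    f p (sSup D) ≤ ⨆ x ∈ D, f p x

/-- `μ a + μ b ≤ μ c + μ d`, in geometric form. -/
def SumLE [Order.Frame M] (f : ℚ → S → M) (a b c d : S) : Prop :=
  ∀ p q, f p a ⊓ f q b ≤ ⨆ p', ⨆ q', ⨆ _ : p' + q' = p + q, f p' c ⊓ f q' d

/-- `μ a + μ b ≤ μ c + μ d`, in finitary form. -/
def SumDisj [Order.Frame M] (f : ℚ → S → M) (a b c d : S) : Prop :=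
  ∀ p q r s, p + q = r + s → f p a ⊓ f q b ≤ f r c ⊔ f s d

/-- The modular law. -/
structure IsModularFamily [Lattice S] [Order.Frame M] (f : ℚ → S → M) : Prop where
  inf_sup : ∀ a b, SumLE f a b (a ⊓ b) (a ⊔ b)
  of_inf_sup : ∀ a b, SumLE f (a ⊓ b) (a ⊔ b) a b

/-! ### The geometric and the finitary modular law -/

section Disj

variable [Lattice S] [BoundedOrder S] [Order.Frame M] {lo hi : Set ℚ} {f : ℚ → S → M}

/-- If `p' + q' = r + s`, then `r ≤ p'` or `s ≤ q'`; only monotonicity is needed. -/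
theorem SumLE.sumDisj (hf : IsBoundedFamily lo hi f) {a b c d : S} (h : SumLE f a b c d) :
    SumDisj f a b c d := fun p q r s e => by
  refine (h p q).trans (iSup_le fun p' => iSup₂_le fun q' e' => ?_)
  rcases le_or_gt r p' with hr | hr
  · exact inf_le_left.trans ((hf.mono hr le_rfl).trans le_sup_left)
  · exact inf_le_right.trans ((hf.mono (by linarith) le_rfl).trans le_sup_right)

/-- With values bounded on one side, the finitary form of an inequality between sums implies the
geometric one, by search along an arithmetic progression. -/
theorem SumDisj.sumLE (hf : IsBoundedFamily lo hi f) (hb : (lo ∪ hi).Nonempty)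
    (hround : ∀ p a, f p a ≤ ⨆ q, ⨆ _ : p < q, f q a) {a b c d : S} (h : SumDisj f a b c d) :
    SumLE f a b c d := fun p q => by
  set T := ⨆ p', ⨆ q', ⨆ _ : p' + q' = p + q, f p' c ⊓ f q' d with hT
  have le_T : ∀ {r s}, p + q ≤ r + s → f r c ⊓ f s d ≤ T := fun {r s} hrs => by
    have h1 : f r c ⊓ f s d ≤ f r c ⊓ f (p + q - r) d :=
      inf_le_inf_left _ (hf.mono (by linarith) le_rfl)
    refine h1.trans ?_
    exact le_iSup_of_le r (le_iSup₂_of_le (f := fun q' (_ : r + q' = p + q) => f r c ⊓ f q' d)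
      (p + q - r) (by ring) le_rfl)
  refine (inf_le_inf (hround p a) (hround q b)).trans ?_
  rw [iSup₂_inf_eq]
  refine iSup₂_le fun p₁ hp₁ => ?_
  rw [inf_iSup₂_eq]
  refine iSup₂_le fun q₁ hq₁ => ?_
  set z := f p₁ a ⊓ f q₁ b
  -- The slack gained by rounding both hypotheses is the stride of the search.
  set ε := p₁ + q₁ - (p + q) with hε
  have hε0 : 0 < ε := by linarith
  have hz : ∀ r, z ≤ f r c ⊔ f (p₁ + q₁ - r) d := fun r => h _ _ _ _ (by ring)
  -- At each new point `r` the finitary law gives `f r c`, and the walk goes on, or `f (p₁ + q₁ - r)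
  -- d`. In the latter case the previous point `r - ε` still holds for `c`, and the two rationals
  -- add up to `p₁ + q₁ - ε = p + q`, which lands in `T`.
  have step : ∀ r₀, z ≤ f r₀ c → ∀ N : ℕ, z ≤ T ⊔ f (r₀ + N * ε) c := fun r₀ h₀ N => by
    induction N with
    | zero => simpa using le_sup_of_le_right h₀
    | succ N ih =>
      refine (le_inf ih (hz (r₀ + (N + 1 : ℕ) * ε))).trans ?_
      rw [inf_sup_right]
      refine sup_le (inf_le_left.trans le_sup_left) ?_
      rw [inf_sup_left]
      refine sup_le (inf_le_right.trans le_sup_right) ((le_T ?_).trans le_sup_left)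
      push_cast
      linarith
  have finish : ∀ r₀ R, z ≤ f r₀ c → (∀ r, R < r → f r c ≤ T) → z ≤ T := fun r₀ R h₀ hR => by
    obtain ⟨N, hN⟩ := exists_nat_gt ((R - r₀) / ε)
    rw [div_lt_iff₀ hε0] at hN
    exact (step r₀ h₀ N).trans (sup_le le_rfl (hR _ (by linarith)))
  obtain ⟨k, hk | hk⟩ := hb
  -- With a lower bound `k`, the walk starts below `k`, where `f` is `⊤`. It stops once the
  -- complementary rational `p + q - r` drops below `k`, where the condition on `d` is free.
  · refine finish (k - 1) (p + q - k + 1) ?_ fun r hr => ?_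
    · rw [hf.lo_top k hk (k - 1) (by linarith)]
      exact le_top
    · refine le_trans (le_inf le_rfl ?_) (le_T (s := p + q - r) (by linarith))
      rw [hf.lo_top k hk (p + q - r) (by linarith)]
      exact le_top
  -- With an upper bound `k`, the walk starts where the alternative for `d` would exceed `k`, hence
  -- is `⊥`, and stops when the rational for `c` exceeds `k`.
  · refine finish (p₁ + q₁ - (k + 1)) k ?_ fun r hr => ?_
    · refine (hz (p₁ + q₁ - (k + 1))).trans (sup_le le_rfl ?_)
      rw [hf.hi_bot k hk (p₁ + q₁ - (p₁ + q₁ - (k + 1))) (by linarith)]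
      exact bot_le
    · rw [hf.hi_bot k hk r hr]
      exact bot_le

theorem sumLE_iff_sumDisj (hf : IsBoundedFamily lo hi f) (hb : (lo ∪ hi).Nonempty)
    (hround : ∀ p a, f p a ≤ ⨆ q, ⨆ _ : p < q, f q a) {a b c d : S} :
    SumLE f a b c d ↔ SumDisj f a b c d :=
  ⟨SumLE.sumDisj hf, SumDisj.sumLE hf hb hround⟩

end Disj

/-! ### Extension of families from the lattice to its spectrum -/

section Extension

variable [DistribLattice S] [BoundedOrder S] [StrongProximityLattice S] [Order.Frame M]
  {lo hi : Set ℚ} {f : ℚ → S → M}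

theorem prec_trans {a b c : S} (h : a ≺ b) (k : b ≺ c) : a ≺ c := (prec_iff_exists a c).2 ⟨b, h, k⟩

theorem IsProximalFamily.round_rat (hp : IsProximalFamily f)
    (p : ℚ) (a : S) : f p a ≤ ⨆ q, ⨆ _ : p < q, f q a := by
  refine (hp.round p a).trans (iSup_le fun q => iSup₂_le fun b hb => ?_)
  obtain ⟨r, hpr, hrq⟩ := exists_between hb.1
  exact (hp.prec hrq hb.2).trans (le_iSup₂_of_le r hpr le_rfl)

/-- The axiom `prec` costs a strict drop in the rational; rounding up first pays for it. -/
theorem IsProximalFamily.le_of_prec (hp : IsProximalFamily f) (p : ℚ) {a b : S} (h : a ≺ b) :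
    f p a ≤ f p b :=
  (hp.round p a).trans <| iSup_le fun _ => iSup₂_le fun _ hc => hp.prec hc.1 (prec_trans hc.2 h)

namespace RoundedIdeal

theorem down_mono {a b : S} (h : a ≤ b) : down a ≤ down b := fun _ hx => prec_of_prec_of_le hx h

theorem down_le_of_mem {I : RoundedIdeal S} {a : S} (h : a ∈ I.carrier) : down a ≤ I :=
  fun b hb => (I.rounded b).2 ⟨a, hb, h⟩

theorem down_le_down_of_prec {a b : S} (h : a ≺ b) : down a ≤ down b := down_le_of_mem h

theorem down_bot : down (⊥ : S) = ⊥ :=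
  le_bot_iff.1 fun a ha => by rw [eq_bot_of_prec_bot ha]; exact bot_mem _

theorem down_top : down (⊤ : S) = ⊤ := top_le_iff.1 fun a _ => prec_top a

theorem down_inf (a b : S) : down (a ⊓ b) = down a ⊓ down b :=
  le_antisymm (le_inf (down_mono inf_le_left) (down_mono inf_le_right)) fun _ h => prec_inf h.1 h.2

theorem mem_sup_iff {I J : RoundedIdeal S} {x : S} :
    x ∈ (I ⊔ J).carrier ↔ ∃ a ∈ I.carrier, ∃ b ∈ J.carrier, x ≺ a ⊔ b := by
  constructor
  · let K : RoundedIdeal S :=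
      { carrier := {x | ∃ a ∈ I.carrier, ∃ b ∈ J.carrier, x ≺ a ⊔ b}
        lower := fun h ⟨a, ha, b, hb, k⟩ => ⟨a, ha, b, hb, prec_of_le_of_prec h k⟩
        bot_mem := ⟨⊥, I.bot_mem, ⊥, J.bot_mem, bot_prec _⟩
        sup_mem := fun ⟨a, ha, b, hb, k⟩ ⟨a', ha', b', hb', k'⟩ =>
          ⟨a ⊔ a', I.sup_mem ha ha', b ⊔ b', J.sup_mem hb hb',
            sup_prec (prec_of_prec_of_le k (sup_le_sup le_sup_left le_sup_left))
              (prec_of_prec_of_le k' (sup_le_sup le_sup_right le_sup_right))⟩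
        rounded := fun x => ⟨fun ⟨a, ha, b, hb, k⟩ =>
          let ⟨y, hxy, hy⟩ := (prec_iff_exists _ _).1 k
          ⟨y, hxy, a, ha, b, hb, hy⟩, fun ⟨_, hxy, a, ha, b, hb, k⟩ =>
          ⟨a, ha, b, hb, prec_trans hxy k⟩⟩ }
    have hI : I ≤ K := fun y hy => by
      obtain ⟨a, hya, ha⟩ := (I.rounded y).1 hy
      exact ⟨a, ha, ⊥, J.bot_mem, prec_of_prec_of_le hya le_sup_left⟩
    have hJ : J ≤ K := fun y hy => by
      obtain ⟨b, hyb, hb⟩ := (J.rounded y).1 hy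
      exact ⟨⊥, I.bot_mem, b, hb, prec_of_prec_of_le hyb le_sup_right⟩
    have h : I ⊔ J ≤ K := sup_le hI hJ
    exact fun hx => h hx
  · rintro ⟨a, ha, b, hb, h⟩
    have hI : I ≤ I ⊔ J := le_sup_left
    have hJ : J ≤ I ⊔ J := le_sup_right
    exact ((I ⊔ J).rounded x).2 ⟨_, h, (I ⊔ J).sup_mem (hI ha) (hJ hb)⟩

/-- This is where the join condition on `≺` enters the spectrum. With `down_inf`, it makes the
modular law restrict along `down`. -/
theorem down_sup (a b : S) : down (a ⊔ b) = down a ⊔ down b := by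
  refine le_antisymm (fun x hx => ?_) (sup_le (down_mono le_sup_left) (down_mono le_sup_right))
  obtain ⟨y, hxy, hy⟩ := (prec_iff_exists _ _).1 hx
  obtain ⟨a', b', h, ha, hb⟩ := exists_of_prec_sup hy
  exact mem_sup_iff.2 ⟨a', ha, b', hb, prec_of_prec_of_le hxy h⟩

theorem directedOn_down (I : RoundedIdeal S) : DirectedOn (· ≤ ·) (down '' I.carrier) := by
  rintro _ ⟨a, ha, rfl⟩ _ ⟨b, hb, rfl⟩
  exact ⟨_, ⟨a ⊔ b, I.sup_mem ha hb, rfl⟩, down_mono le_sup_left, down_mono le_sup_right⟩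

theorem sSup_down (I : RoundedIdeal S) : sSup (down '' I.carrier) = I := by
  refine le_antisymm (sSup_le ?_) fun a ha => ?_
  · rintro _ ⟨a, ha, rfl⟩
    exact down_le_of_mem ha
  · obtain ⟨b, hab, hb⟩ := (I.rounded a).1 ha
    have h : down b ≤ sSup (down '' I.carrier) := le_sSup ⟨b, hb, rfl⟩
    exact h hab

/-- Directed joins of rounded ideals are unions, so the extension by joins over members is
automatically Scott continuous. -/
theorem mem_sSup_of_directedOn {D : Set (RoundedIdeal S)} (hD : D.Nonempty)
    (hdir : DirectedOn (· ≤ ·) D) {x : S} (hx : x ∈ (sSup D).carrier) :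
    ∃ I ∈ D, x ∈ I.carrier := by
  classical
  obtain ⟨F, hF, hx⟩ := hx
  suffices h : ∃ I ∈ D, F.sup id ∈ I.carrier by
    obtain ⟨I, hI, h⟩ := h
    exact ⟨I, hI, down_le_of_mem h hx⟩
  clear hx
  induction F using Finset.induction_on with
  | empty => obtain ⟨I, hI⟩ := hD; exact ⟨I, hI, I.bot_mem⟩
  | insert a F _ ih =>
    obtain ⟨I, hI, h⟩ := ih fun b hb => hF b (Finset.mem_insert_of_mem hb)
    obtain ⟨J, hJ, h'⟩ := hF a (Finset.mem_insert_self _ _)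
    obtain ⟨K, hK, hIK, hJK⟩ := hdir I hI J hJ
    rw [Finset.sup_insert]
    exact ⟨K, hK, K.sup_mem (hJK h') (hIK h)⟩

end RoundedIdeal

open RoundedIdeal

/-- The extension of a family over `S` to the rounded ideals of `S`. -/
def extendFamily (f : ℚ → S → M) (p : ℚ) (I : Spec S) : M := ⨆ a ∈ I.carrier, f p a

theorem le_extendFamily {p : ℚ} {I : Spec S} {a : S} (h : a ∈ I.carrier) :
    f p a ≤ extendFamily f p I :=
  le_iSup₂_of_le (f := fun a (_ : a ∈ I.carrier) => f p a) a h le_rfl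

theorem extendFamily_inf (p q : ℚ) (I J : Spec S) :
    extendFamily f p I ⊓ extendFamily f q J =
      ⨆ a ∈ I.carrier, ⨆ b ∈ J.carrier, f p a ⊓ f q b := by
  rw [extendFamily, iSup₂_inf_eq]
  simp only [extendFamily, inf_iSup₂_eq]

theorem extendFamily_down (hp : IsProximalFamily f) (p : ℚ) (a : S) :
    extendFamily f p (down a) = f p a := by
  refine le_antisymm (iSup₂_le fun b hb => hp.le_of_prec p hb) ?_
  refine (hp.round p a).trans (iSup_le fun q => iSup₂_le fun b hb => ?_)
  obtain ⟨c, hbc, hc⟩ := (prec_iff_exists _ _).1 hb.2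
  exact (hp.prec hb.1 hbc).trans (le_extendFamily hc)

theorem IsBoundedFamily.extend (hf : IsBoundedFamily lo hi f) :
    IsBoundedFamily lo hi (extendFamily f) where
  mono hqp hIJ := iSup₂_le fun _ ha => (hf.mono hqp le_rfl).trans (le_extendFamily (hIJ ha))
  lo_top c hc p hpc I := top_le_iff.1 <|
    (hf.lo_top c hc p hpc ⊥).ge.trans (le_extendFamily I.bot_mem)
  lo_bot c hc p hpc := le_bot_iff.1 <| iSup₂_le fun a ha => by
    rw [← down_bot] at ha
    rw [eq_bot_of_prec_bot ha, hf.lo_bot c hc p hpc]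
  hi_top c hc p hpc := top_le_iff.1 <| by
    rw [← down_top]
    exact (hf.hi_top c hc p hpc).ge.trans (le_extendFamily (prec_top (⊤ : S)))
  hi_bot c hc p hpc I := le_bot_iff.1 <| iSup₂_le fun a _ => (hf.hi_bot c hc p hpc a).le

theorem IsProximalFamily.extend (hp : IsProximalFamily f) :
    IsScottFamily (extendFamily f) where
  round p I := iSup₂_le fun a ha => (hp.round_rat p a).trans <|
    iSup₂_mono fun _ _ => le_extendFamily ha
  scott p D hD hdir := iSup₂_le fun a ha => by
    obtain ⟨I, hI, haI⟩ := mem_sSup_of_directedOn hD hdir ha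
    exact (le_extendFamily haI).trans
      (le_iSup₂_of_le (f := fun I (_ : I ∈ D) => extendFamily f p I) I hI le_rfl)

theorem IsModularFamily.extend (hf : IsBoundedFamily lo hi f) (hp : IsProximalFamily f)
    (hm : IsModularFamily f) : IsModularFamily (extendFamily f) where
  inf_sup I J p q := by
    rw [extendFamily_inf]
    refine iSup₂_le fun a ha => iSup₂_le fun b hb => (hm.inf_sup a b p q).trans ?_
    have hI : I ≤ I ⊔ J := le_sup_left
    have hJ : J ≤ I ⊔ J := le_sup_right
    refine iSup_mono fun p' => iSup₂_mono fun q' _ => inf_le_inf ?_ ?_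
    · exact le_extendFamily ⟨I.lower inf_le_left ha, J.lower inf_le_right hb⟩
    · exact le_extendFamily ((I ⊔ J).sup_mem (hI ha) (hJ hb))
  of_inf_sup I J p q := by
    rw [extendFamily_inf]
    refine iSup₂_le fun x hx => iSup₂_le fun y hy => ?_
    obtain ⟨a, ha, b, hb, hy⟩ := mem_sup_iff.1 hy
    -- The elements `a` and `b` only cover `y`. As `x` lies in both ideals, it can be joined to
    -- each, so that the meet covers `x` too without leaving `I` or `J`.
    have hle : f p x ⊓ f q y ≤ f p ((a ⊔ x) ⊓ (b ⊔ x)) ⊓ f q ((a ⊔ x) ⊔ (b ⊔ x)) :=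
      inf_le_inf (hf.mono le_rfl (le_inf le_sup_right le_sup_right))
        ((hp.le_of_prec q hy).trans (hf.mono le_rfl (sup_le_sup le_sup_left le_sup_left)))
    refine hle.trans ((hm.of_inf_sup _ _ p q).trans ?_)
    refine iSup_mono fun p' => iSup₂_mono fun q' _ => inf_le_inf ?_ ?_
    · exact le_extendFamily (I.sup_mem ha hx.1)
    · exact le_extendFamily (J.sup_mem hb hx.2)

variable {F : ℚ → Spec S → M}

/-- A rounded ideal is the directed join of the `down a` for its members `a`, so Scott continuity
leaves no freedom beyond the values on `S`. -/
theorem IsScottFamily.eq_iSup (hF : IsBoundedFamily lo hi F) (hs : IsScottFamily F) (p : ℚ)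
    (I : Spec S) : F p I = ⨆ a ∈ I.carrier, F p (down a) := by
  refine le_antisymm ?_ (iSup₂_le fun a ha => hF.mono le_rfl (down_le_of_mem ha))
  have h := hs.scott p (down '' I.carrier) ⟨_, ⊥, I.bot_mem, rfl⟩ (directedOn_down I)
  rwa [sSup_down, iSup_image] at h

theorem IsBoundedFamily.restrict (hF : IsBoundedFamily lo hi F) :
    IsBoundedFamily lo hi fun p a => F p (down a) where
  mono hqp hab := hF.mono hqp (down_mono hab)
  lo_top c hc p hpc a := hF.lo_top c hc p hpc _
  lo_bot c hc p hpc := by rw [down_bot]; exact hF.lo_bot c hc p hpc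
  hi_top c hc p hpc := by rw [down_top]; exact hF.hi_top c hc p hpc
  hi_bot c hc p hpc a := hF.hi_bot c hc p hpc _

theorem IsScottFamily.restrict (hF : IsBoundedFamily lo hi F) (hs : IsScottFamily F) :
    IsProximalFamily fun p a => F p (down a) where
  prec hqp hab := hF.mono hqp.le (down_le_down_of_prec hab)
  round p a := by
    refine (hs.round p (down a)).trans (iSup₂_le fun q hq => ?_)
    rw [hs.eq_iSup hF]
    exact iSup₂_le fun b hb => le_iSup_of_le q
      (le_iSup₂_of_le (f := fun b (_ : p < q ∧ b ≺ a) => F q (down b)) b ⟨hq, hb⟩ le_rfl)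

theorem IsModularFamily.restrict (hm : IsModularFamily F) :
    IsModularFamily fun p a => F p (down a) where
  inf_sup a b := by
    have := hm.inf_sup (down a) (down b)
    rwa [← down_inf, ← down_sup] at this
  of_inf_sup a b := by
    have := hm.of_inf_sup (down a) (down b)
    rwa [← down_inf, ← down_sup] at this

/-- A family over `S` extends uniquely to the spectrum. -/
theorem eq_extendFamily (hF : IsBoundedFamily lo hi F) (hs : IsScottFamily F)
    (h : ∀ p a, F p (down a) = f p a) : F = extendFamily f := by
  ext p I
  rw [hs.eq_iSup hF]
  simp only [h, extendFamily]

end Extension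

/-! ### Functoriality along frame homomorphisms -/

section Comap

variable {X : Type u} {Y : Type w} [Order.Frame X] [Order.Frame Y] [Order.Frame M]
  {lo hi : Set ℚ} {F : ℚ → Y → M} (φ : FrameHom X Y)

theorem IsBoundedFamily.comap (hF : IsBoundedFamily lo hi F) :
    IsBoundedFamily lo hi fun p x => F p (φ x) where
  mono hqp hab := hF.mono hqp (OrderHomClass.mono φ hab)
  lo_top c hc p hpc a := hF.lo_top c hc p hpc _
  lo_bot c hc p hpc := by rw [map_bot]; exact hF.lo_bot c hc p hpc
  hi_top c hc p hpc := by rw [map_top]; exact hF.hi_top c hc p hpc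
  hi_bot c hc p hpc a := hF.hi_bot c hc p hpc _

theorem IsScottFamily.comap (hF : IsScottFamily F) : IsScottFamily fun p x => F p (φ x) where
  round p x := hF.round p _
  scott p D hD hdir := by
    rw [map_sSup, ← iSup_image (f := φ) (g := fun y => F p y)]
    refine hF.scott p _ (hD.image φ) ?_
    rintro _ ⟨d, hd, rfl⟩ _ ⟨e, he, rfl⟩
    obtain ⟨c, hc, hdc, hec⟩ := hdir d hd e he
    exact ⟨_, ⟨c, hc, rfl⟩, OrderHomClass.mono φ hdc, OrderHomClass.mono φ hec⟩

theorem IsModularFamily.comap (hm : IsModularFamily F) : IsModularFamily fun p x => F p (φ x) where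
  inf_sup a b := by
    have := hm.inf_sup (φ a) (φ b)
    rwa [← map_inf, ← map_sup] at this
  of_inf_sup a b := by
    have := hm.of_inf_sup (φ a) (φ b)
    rwa [← map_inf, ← map_sup] at this

end Comap

end Curried

/-! ### Interpolation for the generating entailments -/

section EntailmentAxioms

variable {S : Type u} (n : ℚ ≃+ ℚ) (lo hi : Set ℚ)

/-- The entailments that express boundedness and monotonicity, where `⟨n p, a⟩` is read as
`p < μ a`. -/
inductive BoundEnt (S : Type u) [Lattice S] [BoundedOrder S] :
    Finset (ValGen S) → Finset (ValGen S) → Prop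
  | lo_top (c p : ℚ) (a : S) : c ∈ lo → p < c → BoundEnt S ∅ {⟨n p, a⟩}
  | lo_bot (c p : ℚ) : c ∈ lo → c < p → BoundEnt S {⟨n p, ⊥⟩} ∅
  | hi_top (c p : ℚ) : c ∈ hi → p < c → BoundEnt S ∅ {⟨n p, ⊤⟩}
  | hi_bot (c p : ℚ) (a : S) : c ∈ hi → c < p → BoundEnt S {⟨n p, a⟩} ∅
  | mono (p q : ℚ) (a b : S) : q ≤ p → a ≤ b → BoundEnt S {⟨n p, a⟩} {⟨n q, b⟩}

variable [DistribLattice S] [BoundedOrder S] [StrongProximityLattice S]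

/-- The proximity on generators, where `⟨n p, a⟩` is read as `p < μ a`. -/
structure GenPrec (g h : ValGen S) : Prop where
  rat_lt : n.symm h.rat < n.symm g.rat
  elt_prec : g.elt ≺ h.elt

variable {n lo hi}

theorem genPrec_mk {p q : ℚ} {a b : S} : GenPrec n ⟨n p, a⟩ ⟨n q, b⟩ ↔ q < p ∧ a ≺ b :=
  ⟨fun h => ⟨by simpa using h.1, h.2⟩, fun h => ⟨by simpa using h.1, h.2⟩⟩

theorem genPrec_iff_exists (g h : ValGen S) :
    GenPrec n g h ↔ ∃ k, GenPrec n g k ∧ GenPrec n k h := by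
  constructor
  · rintro ⟨hr, he⟩
    obtain ⟨q, hq, hq'⟩ := exists_between hr
    obtain ⟨b, hb, hb'⟩ := (prec_iff_exists _ _).1 he
    exact ⟨⟨n q, b⟩, ⟨by simpa using hq', hb⟩, ⟨by simpa using hq, hb'⟩⟩
  · rintro ⟨k, hk, hk'⟩
    exact ⟨hk'.1.trans hk.1, prec_trans hk.2 hk'.2⟩

theorem UpperExt.exists_genPrec {A C : Finset (ValGen S)} (h : UpperExt (GenPrec n) A C) {p : ℚ}
    {a : S} (hC : ⟨n p, a⟩ ∈ C) : ∃ q b, ⟨n q, b⟩ ∈ A ∧ p < q ∧ b ≺ a := by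
  obtain ⟨⟨q, b⟩, hA, hq, hb⟩ := h _ hC
  exact ⟨n.symm q, b, by simpa using hA, by simpa using hq, hb⟩

theorem LowerExt.exists_genPrec {C B : Finset (ValGen S)} (h : LowerExt (GenPrec n) C B) {p : ℚ}
    {a : S} (hC : ⟨n p, a⟩ ∈ C) : ∃ q b, ⟨n q, b⟩ ∈ B ∧ q < p ∧ a ≺ b := by
  obtain ⟨⟨q, b⟩, hB, hq, hb⟩ := h _ hC
  exact ⟨n.symm q, b, by simpa using hB, by simpa using hq, hb⟩

-- Allows an axiom with two premises to be used when only stronger generators are available on the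
-- left.
open Classical in
theorem IsEntailmentRelation.cut_pair_left {G : Type u} {E : Finset G → Finset G → Prop}
    (hE : IsEntailmentRelation E) {g g' h h' : G} {A B : Finset G} (hg : E {g'} {g})
    (hh : E {h'} {h}) (H : E {g, h} B) (hgA : g' ∈ A) (hhA : h' ∈ A) : E A B := by
  refine hE.cut A B g (hE.weaken hg (by simpa using hgA) (by simp)) ?_
  refine hE.cut _ B h (hE.weaken hh (by simp [hhA]) (by simp)) ?_
  exact hE.weaken H (by intro x; simp; tauto) subset_rfl

open Classical in
theorem IsEntailmentRelation.cut_pair_right {G : Type u} {E : Finset G → Finset G → Prop}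
    (hE : IsEntailmentRelation E) {g g' h h' : G} {A B : Finset G} (hg : E {g} {g'})
    (hh : E {h} {h'}) (H : E A {g, h}) (hgB : g' ∈ B) (hhB : h' ∈ B) : E A B :=
  hE.flip.cut_pair_left (E := _root_.flip E) hg hh H hgB hhB

variable (n lo hi) in
/-- The entailments that generate the entailment relations of valuations. -/
abbrev valuationEnt (S : Type u) [DistribLattice S] [BoundedOrder S] [StrongProximityLattice S] :
    Finset (ValGen S) → Finset (ValGen S) → Prop :=
  BoundEnt n lo hi S ⊔ disjEnt₁ S ⊔ disjEnt₂ S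

theorem valuationEnt_of_bound {A B : Finset (ValGen S)} (h : BoundEnt n lo hi S A B) :
    generatedEntailment (valuationEnt n lo hi S) A B :=
  generatedEntailment_of (Or.inl (Or.inl h))

theorem valuationEnt_mono {p q : ℚ} {a b : S} (hqp : q ≤ p) (hab : a ≤ b) :
    generatedEntailment (valuationEnt n lo hi S) {⟨n p, a⟩} {⟨n q, b⟩} :=
  valuationEnt_of_bound (.mono p q a b hqp hab)

open Classical in
theorem valuationEnt_disj₁ {p q r s : ℚ} (a b : S) (h : p + q = r + s) :
    generatedEntailment (valuationEnt n lo hi S) {⟨n p, a⟩, ⟨n q, b⟩}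
      {⟨n r, a ⊓ b⟩, ⟨n s, a ⊔ b⟩} :=
  generatedEntailment_of (Or.inl (Or.inr ⟨_, _, _, _, a, b, by rw [← map_add, h, map_add]⟩))

open Classical in
theorem valuationEnt_disj₂ {p q r s : ℚ} (a b : S) (h : p + q = r + s) :
    generatedEntailment (valuationEnt n lo hi S) {⟨n r, a ⊓ b⟩, ⟨n s, a ⊔ b⟩}
      {⟨n p, a⟩, ⟨n q, b⟩} :=
  generatedEntailment_of (Or.inr ⟨_, _, _, _, a, b, by rw [← map_add, h, map_add]⟩)

theorem exists_add_eq_of_add_lt {x y z : ℚ} (h : x + y < z) :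
    ∃ x' y', x < x' ∧ y < y' ∧ x' + y' = z :=
  ⟨x + (z - (x + y)) / 2, y + (z - (x + y)) / 2, by linarith, by linarith, by ring⟩

theorem exists_add_eq_of_lt_add {x y z : ℚ} (h : z < x + y) :
    ∃ x' y', x' < x ∧ y' < y ∧ x' + y' = z :=
  ⟨x + (z - (x + y)) / 2, y + (z - (x + y)) / 2, by linarith, by linarith, by ring⟩

theorem inf_prec_inf {a b a' b' : S} (h : a ≺ a') (k : b ≺ b') : a ⊓ b ≺ a' ⊓ b' :=
  prec_inf (prec_of_le_of_prec inf_le_left h) (prec_of_le_of_prec inf_le_right k)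

theorem sup_prec_sup {a b a' b' : S} (h : a ≺ a') (k : b ≺ b') : a ⊔ b ≺ a' ⊔ b' :=
  sup_prec (prec_of_prec_of_le h le_sup_left) (prec_of_prec_of_le k le_sup_right)

theorem upperExt_singleton {G : Type u} {r : G → G → Prop} {A : Finset G} {a b : G} (ha : a ∈ A)
    (h : r a b) : UpperExt r A {b} := fun c hc => ⟨a, ha, by rwa [Finset.mem_singleton.1 hc]⟩

theorem lowerExt_singleton {G : Type u} {r : G → G → Prop} {B : Finset G} {a b : G} (hb : b ∈ B)
    (h : r a b) : LowerExt r {a} B := fun c hc => ⟨b, hb, by rwa [Finset.mem_singleton.1 hc]⟩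

open Classical in
theorem upperExt_pair {G : Type u} {r : G → G → Prop} {a b c d : G} (h : r a c) (k : r b d) :
    UpperExt r {a, b} {c, d} := fun x hx => by
  obtain rfl | hx := Finset.mem_insert.1 hx
  · exact ⟨a, by simp, h⟩
  · exact ⟨b, by simp, by rwa [Finset.mem_singleton.1 hx]⟩

open Classical in
theorem lowerExt_pair {G : Type u} {r : G → G → Prop} {a b c d : G} (h : r a c) (k : r b d) :
    LowerExt r {a, b} {c, d} := upperExt_pair (r := flip r) h k

/-- The strict inequality with the bound leaves room for a rational in between. In the lattice, `b ≺
⊥` forces `b = ⊥`, and interpolants without a source can carry an extreme element, since `⊥ ≺ a` and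
`⊤ ≺ ⊤`. -/
theorem exists_lowerExt_of_boundEnt {C D : Finset (ValGen S)}
    (h : BoundEnt n lo hi S C D) (A : Finset (ValGen S)) (hA : UpperExt (GenPrec n) A C) :
    ∃ B, generatedEntailment (valuationEnt n lo hi S) A B ∧ LowerExt (GenPrec n) B D := by
  classical
  have hE := isEntailmentRelation_generated (valuationEnt n lo hi S)
  cases h with
  | lo_top c p a hc hp =>
    obtain ⟨q, hpq, hqc⟩ := exists_between hp
    have hl : GenPrec n ⟨n q, ⊥⟩ ⟨n p, a⟩ := genPrec_mk.2 ⟨hpq, bot_prec a⟩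
    exact ⟨{⟨n q, ⊥⟩}, hE.weaken (valuationEnt_of_bound (.lo_top c q ⊥ hc hqc))
      (Finset.empty_subset _) subset_rfl,
      lowerExt_singleton (Finset.mem_singleton_self _) hl⟩
  | lo_bot c p hc hp =>
    obtain ⟨q, b, hb, hpq, hbot⟩ := hA.exists_genPrec (Finset.mem_singleton_self _)
    obtain rfl := eq_bot_of_prec_bot hbot
    exact ⟨∅, hE.weaken (valuationEnt_of_bound (.lo_bot c q hc (hp.trans hpq)))
      (by simpa using hb) subset_rfl, fun x hx => by simp at hx⟩
  | hi_top c p hc hp =>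
    obtain ⟨q, hpq, hqc⟩ := exists_between hp
    have hl : GenPrec n ⟨n q, ⊤⟩ ⟨n p, (⊤ : S)⟩ := genPrec_mk.2 ⟨hpq, prec_top _⟩
    exact ⟨{⟨n q, ⊤⟩}, hE.weaken (valuationEnt_of_bound (.hi_top c q hc hqc))
      (Finset.empty_subset _) subset_rfl,
      lowerExt_singleton (Finset.mem_singleton_self _) hl⟩
  | hi_bot c p a hc hp =>
    obtain ⟨q, b, hb, hpq, -⟩ := hA.exists_genPrec (Finset.mem_singleton_self _)
    exact ⟨∅, hE.weaken (valuationEnt_of_bound (.hi_bot c q b hc (hp.trans hpq)))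
      (by simpa using hb) subset_rfl, fun x hx => by simp at hx⟩
  | mono p q a b hqp hab =>
    obtain ⟨p', a', ha', hp', haa⟩ := hA.exists_genPrec (Finset.mem_singleton_self _)
    have hl : GenPrec n ⟨n p', a'⟩ ⟨n q, b⟩ :=
      genPrec_mk.2 ⟨hqp.trans_lt hp', prec_of_prec_of_le haa hab⟩
    exact ⟨{⟨n p', a'⟩}, hE.weaken (hE.refl _) (by simpa using ha') subset_rfl,
      lowerExt_singleton (Finset.mem_singleton_self _) hl⟩

/-- The premises can be improved to `a' ≺ a`, `b' ≺ b` with a larger sum of rationals. The proximity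
passes to meets and joins, and the surplus is shared between the two conclusions. -/
theorem exists_lowerExt_of_disjEnt₁ {C D : Finset (ValGen S)}
    (h : disjEnt₁ S C D) (A : Finset (ValGen S)) (hA : UpperExt (GenPrec n) A C) :
    ∃ B, generatedEntailment (valuationEnt n lo hi S) A B ∧ LowerExt (GenPrec n) B D := by
  classical
  have hE := isEntailmentRelation_generated (valuationEnt n lo hi S)
  obtain ⟨p, q, r, s, a, b, e⟩ := h
  obtain ⟨p, rfl⟩ := n.surjective p
  obtain ⟨q, rfl⟩ := n.surjective q
  obtain ⟨r, rfl⟩ := n.surjective r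
  obtain ⟨s, rfl⟩ := n.surjective s
  rw [← map_add, ← map_add, n.injective.eq_iff] at e
  obtain ⟨p', a', ha', hp, ha⟩ := hA.exists_genPrec (p := p) (a := a) (by simp)
  obtain ⟨q', b', hb', hq, hb⟩ := hA.exists_genPrec (p := q) (a := b) (by simp)
  obtain ⟨r', s', hr, hs, e'⟩ := exists_add_eq_of_add_lt (x := r) (y := s) (z := p' + q')
    (by linarith)
  have hl : GenPrec n ⟨n r', a' ⊓ b'⟩ ⟨n r, a ⊓ b⟩ := genPrec_mk.2 ⟨hr, inf_prec_inf ha hb⟩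
  have hl' : GenPrec n ⟨n s', a' ⊔ b'⟩ ⟨n s, a ⊔ b⟩ := genPrec_mk.2 ⟨hs, sup_prec_sup ha hb⟩
  exact ⟨_, hE.weaken (valuationEnt_disj₁ a' b' e'.symm)
    (Finset.insert_subset ha' (by simpa using hb')) subset_rfl, lowerExt_pair hl hl'⟩

/-- Here a given `y ≺ a ⊔ b` has to be split, which is the join condition on `≺`. -/
theorem exists_lowerExt_of_disjEnt₂ {C D : Finset (ValGen S)}
    (h : disjEnt₂ S C D) (A : Finset (ValGen S)) (hA : UpperExt (GenPrec n) A C) :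
    ∃ B, generatedEntailment (valuationEnt n lo hi S) A B ∧ LowerExt (GenPrec n) B D := by
  classical
  have hE := isEntailmentRelation_generated (valuationEnt n lo hi S)
  obtain ⟨p, q, r, s, a, b, e⟩ := h
  obtain ⟨p, rfl⟩ := n.surjective p
  obtain ⟨q, rfl⟩ := n.surjective q
  obtain ⟨r, rfl⟩ := n.surjective r
  obtain ⟨s, rfl⟩ := n.surjective s
  rw [← map_add, ← map_add, n.injective.eq_iff] at e
  obtain ⟨r', x, hx', hr, hx⟩ := hA.exists_genPrec (p := r) (a := a ⊓ b) (by simp)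
  obtain ⟨s', y, hy', hs, hy⟩ := hA.exists_genPrec (p := s) (a := a ⊔ b) (by simp)
  obtain ⟨a', b', hle, ha, hb⟩ := exists_of_prec_sup hy
  obtain ⟨p', q', hp, hq, e'⟩ := exists_add_eq_of_add_lt (x := p) (y := q) (z := r' + s')
    (by linarith)
  -- Joining `x` to both halves keeps them below `a` and `b`, because `x ≺ a ⊓ b`, and puts `x`
  -- below their meet.
  have hl : GenPrec n ⟨n p', a' ⊔ x⟩ ⟨n p, a⟩ :=
    genPrec_mk.2 ⟨hp, sup_prec ha (prec_of_prec_of_le hx inf_le_left)⟩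
  have hl' : GenPrec n ⟨n q', b' ⊔ x⟩ ⟨n q, b⟩ :=
    genPrec_mk.2 ⟨hq, sup_prec hb (prec_of_prec_of_le hx inf_le_right)⟩
  exact ⟨{⟨n p', a' ⊔ x⟩, ⟨n q', b' ⊔ x⟩},
    hE.cut_pair_left (valuationEnt_mono le_rfl (le_inf le_sup_right le_sup_right))
      (valuationEnt_mono le_rfl (hle.trans (sup_le_sup le_sup_left le_sup_left)))
      (valuationEnt_disj₂ _ _ e') hx' hy', lowerExt_pair hl hl'⟩

theorem exists_lowerExt_of_valuationEnt (C D : Finset (ValGen S))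
    (h : valuationEnt n lo hi S C D) (A : Finset (ValGen S)) (hA : UpperExt (GenPrec n) A C) :
    ∃ B, generatedEntailment (valuationEnt n lo hi S) A B ∧ LowerExt (GenPrec n) B D := by
  obtain (h | h) | h : (BoundEnt n lo hi S C D ∨ disjEnt₁ S C D) ∨ disjEnt₂ S C D := h
  · exact exists_lowerExt_of_boundEnt h _ hA
  · exact exists_lowerExt_of_disjEnt₁ h _ hA
  · exact exists_lowerExt_of_disjEnt₂ h _ hA

/-- Order dual of the interpolation on the right: now `⊤ ≺ b` forces `b = ⊤`. -/
theorem exists_upperExt_of_boundEnt {C D : Finset (ValGen S)}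
    (h : BoundEnt n lo hi S C D) (B : Finset (ValGen S)) (hB : LowerExt (GenPrec n) D B) :
    ∃ A, UpperExt (GenPrec n) C A ∧ generatedEntailment (valuationEnt n lo hi S) A B := by
  classical
  have hE := isEntailmentRelation_generated (valuationEnt n lo hi S)
  cases h with
  | lo_top c p a hc hp =>
    obtain ⟨q, b, hb, hqp, -⟩ := hB.exists_genPrec (Finset.mem_singleton_self _)
    exact ⟨∅, fun x hx => by simp at hx,
      hE.weaken (valuationEnt_of_bound (.lo_top c q b hc (hqp.trans hp))) subset_rfl
      (by simpa using hb)⟩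
  | lo_bot c p hc hp =>
    obtain ⟨q, hcq, hqp⟩ := exists_between hp
    have hu : GenPrec n ⟨n p, ⊥⟩ ⟨n q, (⊥ : S)⟩ := genPrec_mk.2 ⟨hqp, bot_prec _⟩
    exact ⟨{⟨n q, ⊥⟩}, upperExt_singleton (Finset.mem_singleton_self _) hu,
      hE.weaken (valuationEnt_of_bound (.lo_bot c q hc hcq)) subset_rfl (Finset.empty_subset _)⟩
  | hi_top c p hc hp =>
    obtain ⟨q, b, hb, hqp, htop⟩ := hB.exists_genPrec (Finset.mem_singleton_self _)
    obtain rfl := eq_top_of_top_prec htop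
    exact ⟨∅, fun x hx => by simp at hx,
      hE.weaken (valuationEnt_of_bound (.hi_top c q hc (hqp.trans hp))) subset_rfl
      (by simpa using hb)⟩
  | hi_bot c p a hc hp =>
    obtain ⟨q, hcq, hqp⟩ := exists_between hp
    have hu : GenPrec n ⟨n p, a⟩ ⟨n q, ⊤⟩ := genPrec_mk.2 ⟨hqp, prec_top _⟩
    exact ⟨{⟨n q, ⊤⟩}, upperExt_singleton (Finset.mem_singleton_self _) hu,
      hE.weaken (valuationEnt_of_bound (.hi_bot c q ⊤ hc hcq)) subset_rfl
      (Finset.empty_subset _)⟩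
  | mono p q a b hqp hab =>
    obtain ⟨q', b', hb', hq', hbb⟩ := hB.exists_genPrec (Finset.mem_singleton_self _)
    have hu : GenPrec n ⟨n p, a⟩ ⟨n q', b'⟩ :=
      genPrec_mk.2 ⟨hq'.trans_le hqp, prec_of_le_of_prec hab hbb⟩
    exact ⟨{⟨n q', b'⟩}, upperExt_singleton (Finset.mem_singleton_self _) hu,
      hE.weaken (hE.refl _) subset_rfl (by simpa using hb')⟩

/-- The dual situation: a given `x` with `a ⊓ b ≺ x` is split by the meet condition on `≺`. Meeting
both halves with `y`, where `a ⊔ b ≺ y`, puts their join below `y`. -/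
theorem exists_upperExt_of_disjEnt₁ {C D : Finset (ValGen S)}
    (h : disjEnt₁ S C D) (B : Finset (ValGen S)) (hB : LowerExt (GenPrec n) D B) :
    ∃ A, UpperExt (GenPrec n) C A ∧ generatedEntailment (valuationEnt n lo hi S) A B := by
  classical
  have hE := isEntailmentRelation_generated (valuationEnt n lo hi S)
  obtain ⟨p, q, r, s, a, b, e⟩ := h
  obtain ⟨p, rfl⟩ := n.surjective p
  obtain ⟨q, rfl⟩ := n.surjective q
  obtain ⟨r, rfl⟩ := n.surjective r
  obtain ⟨s, rfl⟩ := n.surjective s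
  rw [← map_add, ← map_add, n.injective.eq_iff] at e
  obtain ⟨r', x, hx', hr, hx⟩ := hB.exists_genPrec (p := r) (a := a ⊓ b) (by simp)
  obtain ⟨s', y, hy', hs, hy⟩ := hB.exists_genPrec (p := s) (a := a ⊔ b) (by simp)
  obtain ⟨a', b', ha, hb, hle⟩ := exists_of_inf_prec hx
  obtain ⟨p', q', hp, hq, e'⟩ := exists_add_eq_of_lt_add (x := p) (y := q) (z := r' + s')
    (by linarith)
  have hu : GenPrec n ⟨n p, a⟩ ⟨n p', a' ⊓ y⟩ :=
    genPrec_mk.2 ⟨hp, prec_inf ha (prec_of_le_of_prec le_sup_left hy)⟩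
  have hu' : GenPrec n ⟨n q, b⟩ ⟨n q', b' ⊓ y⟩ :=
    genPrec_mk.2 ⟨hq, prec_inf hb (prec_of_le_of_prec le_sup_right hy)⟩
  exact ⟨{⟨n p', a' ⊓ y⟩, ⟨n q', b' ⊓ y⟩}, upperExt_pair hu hu',
    hE.cut_pair_right
      (valuationEnt_mono le_rfl ((inf_le_inf inf_le_left inf_le_left).trans hle))
      (valuationEnt_mono le_rfl (sup_le inf_le_right inf_le_right))
      (valuationEnt_disj₁ _ _ e') hx' hy'⟩

theorem exists_upperExt_of_disjEnt₂ {C D : Finset (ValGen S)}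
    (h : disjEnt₂ S C D) (B : Finset (ValGen S)) (hB : LowerExt (GenPrec n) D B) :
    ∃ A, UpperExt (GenPrec n) C A ∧ generatedEntailment (valuationEnt n lo hi S) A B := by
  classical
  have hE := isEntailmentRelation_generated (valuationEnt n lo hi S)
  obtain ⟨p, q, r, s, a, b, e⟩ := h
  obtain ⟨p, rfl⟩ := n.surjective p
  obtain ⟨q, rfl⟩ := n.surjective q
  obtain ⟨r, rfl⟩ := n.surjective r
  obtain ⟨s, rfl⟩ := n.surjective s
  rw [← map_add, ← map_add, n.injective.eq_iff] at e
  obtain ⟨p', a', ha', hp, ha⟩ := hB.exists_genPrec (p := p) (a := a) (by simp)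
  obtain ⟨q', b', hb', hq, hb⟩ := hB.exists_genPrec (p := q) (a := b) (by simp)
  obtain ⟨r', s', hr, hs, e'⟩ := exists_add_eq_of_lt_add (x := r) (y := s) (z := p' + q')
    (by linarith)
  have hu : GenPrec n ⟨n r, a ⊓ b⟩ ⟨n r', a' ⊓ b'⟩ := genPrec_mk.2 ⟨hr, inf_prec_inf ha hb⟩
  have hu' : GenPrec n ⟨n s, a ⊔ b⟩ ⟨n s', a' ⊔ b'⟩ := genPrec_mk.2 ⟨hs, sup_prec_sup ha hb⟩
  exact ⟨_, upperExt_pair hu hu',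
    hE.weaken (valuationEnt_disj₂ a' b' e'.symm) subset_rfl
      (Finset.insert_subset ha' (by simpa using hb'))⟩

theorem exists_upperExt_of_valuationEnt (C D : Finset (ValGen S))
    (h : valuationEnt n lo hi S C D) (B : Finset (ValGen S)) (hB : LowerExt (GenPrec n) D B) :
    ∃ A, UpperExt (GenPrec n) C A ∧ generatedEntailment (valuationEnt n lo hi S) A B := by
  obtain (h | h) | h : (BoundEnt n lo hi S C D ∨ disjEnt₁ S C D) ∨ disjEnt₂ S C D := h
  · exact exists_upperExt_of_boundEnt h _ hB
  · exact exists_upperExt_of_disjEnt₁ h _ hB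
  · exact exists_upperExt_of_disjEnt₂ h _ hB

theorem isStrongContEnt_valuationEnt :
    IsStrongContEnt (generatedEntailment (valuationEnt n lo hi S)) (GenPrec n) :=
  isStrongContEnt_generated genPrec_iff_exists exists_lowerExt_of_valuationEnt
    exists_upperExt_of_valuationEnt

end EntailmentAxioms

/-! ### Interpretations of the theories as families -/

section Interpretations

variable {S : Type u} {M : Type v} [Order.Frame M] {n : ℚ ≃+ ℚ} {lo hi : Set ℚ}

/-- A map on generators as a family, where `⟨n p, a⟩` is read as `p < μ a`. -/
abbrev toFamily (n : ℚ ≃+ ℚ) (f : ValGen S → M) (p : ℚ) (a : S) : M := f ⟨n p, a⟩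

theorem isInterpretation_boundEnt [Lattice S] [BoundedOrder S] {f : ValGen S → M} :
    IsInterpretation (finitaryTheory (BoundEnt n lo hi S)) f ↔
      IsBoundedFamily lo hi (toFamily n f) := by
  rw [isInterpretation_finitaryTheory]
  constructor
  · intro h
    refine ⟨fun {p q a b} hqp hab => by simpa using h _ _ (.mono p q a b hqp hab),
      fun c hc p hp a => ?_, fun c hc p hp => ?_, fun c hc p hp => ?_, fun c hc p hp a => ?_⟩
    · simpa using h _ _ (.lo_top c p a hc hp)
    · simpa using h _ _ (.lo_bot c p hc hp)
    · simpa using h _ _ (.hi_top c p hc hp)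
    · simpa using h _ _ (.hi_bot c p a hc hp)
  · rintro h _ _ (⟨c, p, a, hc, hp⟩ | ⟨c, p, hc, hp⟩ | ⟨c, p, hc, hp⟩ | ⟨c, p, a, hc, hp⟩ |
      ⟨p, q, a, b, hqp, hab⟩)
    · simpa using h.lo_top c hc p hp a
    · simpa using h.lo_bot c hc p hp
    · simpa using h.hi_top c hc p hp
    · simpa using h.hi_bot c hc p hp a
    · simpa using h.mono hqp hab

theorem isInterpretation_genPrec [DistribLattice S] [BoundedOrder S] [StrongProximityLattice S]
    {f : ValGen S → M} :
    IsInterpretation (roundTheory (GenPrec n)) f ↔ IsProximalFamily (toFamily n f) := by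
  rw [isInterpretation_roundTheory]
  constructor
  · rintro ⟨h, k⟩
    refine ⟨fun hqp hab => h _ _ (genPrec_mk.2 ⟨hqp, hab⟩), fun p a => (k _).trans ?_⟩
    refine iSup₂_le fun ⟨q, b⟩ hb => ?_
    obtain ⟨q, rfl⟩ := n.surjective q
    exact le_iSup_of_le q (le_iSup₂_of_le (f := fun b (_ : p < q ∧ b ≺ a) => f ⟨n q, b⟩) b
      (genPrec_mk.1 hb) le_rfl)
  · intro h
    constructor
    · rintro ⟨p, a⟩ ⟨q, b⟩ hab
      obtain ⟨p, rfl⟩ := n.surjective p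
      obtain ⟨q, rfl⟩ := n.surjective q
      obtain ⟨hqp, hab⟩ := genPrec_mk.1 hab
      exact h.prec hqp hab
    · rintro ⟨p, a⟩
      obtain ⟨p, rfl⟩ := n.surjective p
      refine (h.round p a).trans (iSup_le fun q => iSup₂_le fun b hb => ?_)
      exact le_iSup₂_of_le (f := fun g (_ : GenPrec n g _) => f g) ⟨n q, b⟩ (genPrec_mk.2 hb) le_rfl

open Classical in
theorem sumLE_toFamily_iff {f : ValGen S → M} {a b c d : S} :
    SumLE (toFamily n f) a b c d ↔ ∀ p q : ℚ, ({⟨p, a⟩, ⟨q, b⟩} : Finset (ValGen S)).inf f ≤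
      ⨆ C ∈ {C : Finset (ValGen S) | ∃ p' q' : ℚ, p' + q' = p + q ∧ C = {⟨p', c⟩, ⟨q', d⟩}},
        C.inf f := by
  rw [n.surjective.forall₂]
  refine forall₂_congr fun p q => ?_
  rw [Finset.inf_insert, Finset.inf_singleton]
  refine iff_of_eq (congrArg _ (le_antisymm ?_ ?_))
  · refine iSup_le fun p' => iSup₂_le fun q' e => ?_
    refine le_iSup₂_of_le {⟨n p', c⟩, ⟨n q', d⟩}
      ⟨n p', n q', by rw [← map_add, e, map_add], rfl⟩ ?_
    rw [Finset.inf_insert, Finset.inf_singleton]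
  · refine iSup₂_le ?_
    rintro _ ⟨p', q', e, rfl⟩
    obtain ⟨p', rfl⟩ := n.surjective p'
    obtain ⟨q', rfl⟩ := n.surjective q'
    rw [← map_add, ← map_add, n.injective.eq_iff] at e
    rw [Finset.inf_insert, Finset.inf_singleton]
    exact le_iSup_of_le p' (le_iSup₂_of_le
      (f := fun q' (_ : p' + q' = p + q) => f ⟨n p', c⟩ ⊓ f ⟨n q', d⟩) q' e le_rfl)

theorem isInterpretation_modularTheory₁ [Lattice S] {f : ValGen S → M} :
    IsInterpretation (modularTheory₁ S) f ↔
      ∀ a b, SumLE (toFamily n f) a b (a ⊓ b) (a ⊔ b) := by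
  simp only [sumLE_toFamily_iff]
  refine ⟨fun h a b p q => h _ _ ⟨p, q, a, b⟩, ?_⟩
  rintro h _ _ ⟨p, q, a, b⟩
  exact h a b p q

theorem isInterpretation_modularTheory₂ [Lattice S] {f : ValGen S → M} :
    IsInterpretation (modularTheory₂ S) f ↔
      ∀ a b, SumLE (toFamily n f) (a ⊓ b) (a ⊔ b) a b := by
  simp only [sumLE_toFamily_iff]
  refine ⟨fun h a b p q => h _ _ ⟨p, q, a, b⟩, ?_⟩
  rintro h _ _ ⟨p, q, a, b⟩
  exact h a b p q

open Classical in
theorem sumDisj_toFamily_iff {f : ValGen S → M} {a b c d : S} :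
    SumDisj (toFamily n f) a b c d ↔ ∀ p q r s : ℚ, p + q = r + s →
      ({⟨p, a⟩, ⟨q, b⟩} : Finset (ValGen S)).inf f ≤
        ({⟨r, c⟩, ⟨s, d⟩} : Finset (ValGen S)).sup f := by
  simp only [Finset.inf_insert, Finset.inf_singleton, Finset.sup_insert, Finset.sup_singleton]
  constructor
  · intro h p q r s e
    obtain ⟨p, rfl⟩ := n.surjective p
    obtain ⟨q, rfl⟩ := n.surjective q
    obtain ⟨r, rfl⟩ := n.surjective r
    obtain ⟨s, rfl⟩ := n.surjective s
    rw [← map_add, ← map_add, n.injective.eq_iff] at e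
    exact h p q r s e
  · exact fun h p q r s e => h _ _ _ _ (by rw [← map_add, e, map_add])

theorem isInterpretation_disjEnt₁ [DistribLattice S] {f : ValGen S → M} :
    IsInterpretation (finitaryTheory (disjEnt₁ S)) f ↔
      ∀ a b, SumDisj (toFamily n f) a b (a ⊓ b) (a ⊔ b) := by
  simp only [isInterpretation_finitaryTheory, sumDisj_toFamily_iff]
  refine ⟨fun h a b p q r s e => h _ _ ⟨p, q, r, s, a, b, e⟩, ?_⟩
  rintro h _ _ ⟨p, q, r, s, a, b, e⟩
  exact h a b p q r s e

theorem isInterpretation_disjEnt₂ [DistribLattice S] {f : ValGen S → M} :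
    IsInterpretation (finitaryTheory (disjEnt₂ S)) f ↔
      ∀ a b, SumDisj (toFamily n f) (a ⊓ b) (a ⊔ b) a b := by
  simp only [isInterpretation_finitaryTheory, sumDisj_toFamily_iff]
  refine ⟨fun h a b p q r s e => h _ _ ⟨r, s, p, q, a, b, e.symm⟩, ?_⟩
  rintro h _ _ ⟨p, q, r, s, a, b, e⟩
  exact h a b r s p q e.symm

/-- Families over `S` that correspond to generalized valuations on `Spec S`. -/
structure IsValuationFamily [DistribLattice S] [BoundedOrder S] [StrongProximityLattice S]
    (lo hi : Set ℚ) (f : ℚ → S → M) : Prop where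
  bounded : IsBoundedFamily lo hi f
  proximal : IsProximalFamily f
  modular : IsModularFamily f

/-- Generalized valuations on a locale. -/
structure IsScottValuation {X : Type u} [Order.Frame X] (lo hi : Set ℚ) (F : ℚ → X → M) :
    Prop where
  bounded : IsBoundedFamily lo hi F
  scott : IsScottFamily F
  modular : IsModularFamily F

variable [DistribLattice S] [BoundedOrder S] [StrongProximityLattice S]

theorem IsScottValuation.restrict {F : ValGen (Spec S) → M}
    (hF : IsScottValuation lo hi (toFamily n F)) :
    IsValuationFamily lo hi (toFamily n fun g : ValGen S => F g.toSpec) :=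
  ⟨hF.bounded.restrict, hF.scott.restrict hF.bounded, hF.modular.restrict⟩

/-- Generalized valuations on `Spec S` are determined by their restrictions to `S`. -/
theorem IsValuationFamily.existsUnique {f : ValGen S → M}
    (hf : IsValuationFamily lo hi (toFamily n f)) :
    ∃! F : ValGen (Spec S) → M, IsScottValuation lo hi (toFamily n F) ∧ ∀ g, F g.toSpec = f g := by
  have hfam : toFamily n (fun g : ValGen (Spec S) =>
      extendFamily (toFamily n f) (n.symm g.rat) g.elt) = extendFamily (toFamily n f) := by
    ext p I
    simp [toFamily]
  refine ⟨fun g => extendFamily (toFamily n f) (n.symm g.rat) g.elt, ⟨?_, fun g => ?_⟩, ?_⟩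
  · rw [hfam]
    exact ⟨hf.bounded.extend, hf.proximal.extend, hf.modular.extend hf.bounded hf.proximal⟩
  · obtain ⟨p, a⟩ := g
    refine (extendFamily_down hf.proximal _ a).trans ?_
    rw [toFamily, n.apply_symm_apply]
    rfl
  · rintro F ⟨hF, hFf⟩
    have h := eq_extendFamily (f := toFamily n f) hF.bounded hF.scott fun p a => hFf ⟨n p, a⟩
    ext ⟨p, I⟩
    have := congrFun (congrFun h (n.symm p)) I
    simpa [toFamily] using this

/-- The finitary form of the modular law. -/
theorem isInterpretation_contEntTheory (hb : (lo ∪ hi).Nonempty) {f : ValGen S → M} :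
    IsInterpretation (contEntTheory (generatedEntailment (valuationEnt n lo hi S)) (GenPrec n)) f ↔
      IsValuationFamily lo hi (toFamily n f) := by
  have hfin : IsInterpretation (finitaryTheory (valuationEnt n lo hi S)) f ↔
      (IsInterpretation (finitaryTheory (BoundEnt n lo hi S)) f ∧
        IsInterpretation (finitaryTheory (disjEnt₁ S)) f) ∧
        IsInterpretation (finitaryTheory (disjEnt₂ S)) f := by
    simp only [isInterpretation_finitaryTheory]
    exact ⟨fun h => ⟨⟨fun A B k => h A B (Or.inl (Or.inl k)),
        fun A B k => h A B (Or.inl (Or.inr k))⟩, fun A B k => h A B (Or.inr k)⟩,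
      fun h A B k => k.elim (fun k => k.elim (h.1.1 A B) (h.1.2 A B)) (h.2 A B)⟩
  rw [contEntTheory, isInterpretation_sup, isInterpretation_generatedEntailment, hfin,
    isInterpretation_boundEnt, isInterpretation_disjEnt₁ (n := n),
    isInterpretation_disjEnt₂ (n := n), isInterpretation_genPrec]
  constructor
  · rintro ⟨⟨⟨h, h₁⟩, h₂⟩, hp⟩
    -- Only this direction needs a one-sided bound and the round axioms.
    exact ⟨h, hp, fun a b => (h₁ a b).sumLE h hb hp.round_rat,
      fun a b => (h₂ a b).sumLE h hb hp.round_rat⟩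
  · rintro ⟨h, hp, hm⟩
    exact ⟨⟨⟨h, fun a b => (hm.inf_sup a b).sumDisj h⟩,
      fun a b => (hm.of_inf_sup a b).sumDisj h⟩, hp⟩

theorem isInterpretation_modularTheory_iff_disjEnt (hb : (lo ∪ hi).Nonempty) {f : ValGen S → M}
    (hf : IsBoundedFamily lo hi (toFamily n f)) (hp : IsProximalFamily (toFamily n f)) :
    (IsInterpretation (modularTheory₁ S) f ↔ IsInterpretation (finitaryTheory (disjEnt₁ S)) f) ∧
    (IsInterpretation (modularTheory₂ S) f ↔ IsInterpretation (finitaryTheory (disjEnt₂ S)) f) := by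
  rw [isInterpretation_disjEnt₁ (n := n), isInterpretation_disjEnt₂ (n := n),
    isInterpretation_modularTheory₁ (n := n), isInterpretation_modularTheory₂ (n := n)]
  exact ⟨forall₂_congr fun a b => sumLE_iff_sumDisj hf hb hp.round_rat,
    forall₂_congr fun a b => sumLE_iff_sumDisj hf hb hp.round_rat⟩

end Interpretations

/-! ### Presentations, points and retracts -/

section Transfer

variable {n : ℚ ≃+ ℚ} {lo hi : Set ℚ}

/-- The interpretations of `T` are the generalized valuations. -/
def Axiomatizes (n : ℚ ≃+ ℚ) (lo hi : Set ℚ) {X : Type u} [Order.Frame X]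
    (T : GeometricTheory (ValGen X)) : Prop :=
  ∀ (M : Type w) [Order.Frame M] (f : ValGen X → M),
    IsInterpretation T f ↔ IsScottValuation lo hi (toFamily n f)

/-- The interpretations of `T` are the families that correspond to generalized valuations on the
spectrum. -/
def AxiomatizesOn (n : ℚ ≃+ ℚ) (lo hi : Set ℚ) {S : Type u} [DistribLattice S] [BoundedOrder S]
    [StrongProximityLattice S] (T : GeometricTheory (ValGen S)) : Prop :=
  ∀ (M : Type w) [Order.Frame M] (f : ValGen S → M),
    IsInterpretation T f ↔ IsValuationFamily lo hi (toFamily n f)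

variable {S : Type u} [DistribLattice S] [BoundedOrder S] [StrongProximityLattice S]

/-- The universe `w` serves the universal property; the copies in `u` are needed because the
universal interpretation takes values in `Space T'`, which lives in `u`. -/
theorem AxiomatizesOn.isPresentedBy {T : GeometricTheory (ValGen S)}
    {T' : GeometricTheory (ValGen (Spec S))} (hT : AxiomatizesOn.{u, w} n lo hi T)
    (hTu : AxiomatizesOn.{u, u} n lo hi T) (hT' : Axiomatizes.{u, w} n lo hi T')
    (hTu' : Axiomatizes.{u, u} n lo hi T') :
    IsPresentedBy.{u, u, w} T fun g => Space.gen T' g.toSpec := by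
  refine (Space.isPresentedBy.{u, w} T').of_restrict ValGen.toSpec ?_ fun M _ f hf => ?_
  · exact (hTu _ _).2 ((hTu' _ _).1 (Space.isPresentedBy.{u, u} T').1).restrict
  · simp only [hT' M]
    exact ((hT M f).1 hf).existsUnique

/-- Models are interpretations in the frame `Prop`, so injectivity and surjectivity are the
uniqueness and existence of the extension to `Spec S` with truth values. -/
theorem bijOn_modelOf {T : GeometricTheory (ValGen S)} {T' : GeometricTheory (ValGen (Spec S))}
    (hT : AxiomatizesOn.{u, 0} n lo hi T) (hT' : Axiomatizes.{u, 0} n lo hi T')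
    {V : (Spec S → Set ℚ) → Prop}
    (hV : ∀ μ, V μ ↔ IsInterpretation T' fun g => g.rat ∈ μ g.elt) :
    Set.BijOn (modelOf (S := S)) {μ | V μ} {α | IsModel T α} := by
  refine ⟨fun μ hμ => ?_, fun μ hμ ν hν h => ?_, fun α hα => ?_⟩
  · refine isModel_iff_isInterpretation.2 ((hT _ _).2 ?_)
    exact ((hT' _ _).1 ((hV μ).1 hμ)).restrict
  · have hμ' := (hT' _ _).1 ((hV μ).1 hμ)
    have hν' := (hT' _ _).1 ((hV ν).1 hν)
    have key := (hμ'.restrict.existsUnique).unique ⟨hμ', fun _ => rfl⟩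
      ⟨hν', fun g => propext (Set.ext_iff.1 h g).symm⟩
    ext I q
    exact iff_of_eq (congrFun key ⟨q, I⟩)
  · obtain ⟨F, ⟨hF, hFα⟩, -⟩ := ((hT _ _).1 (isModel_iff_isInterpretation.1 hα)).existsUnique
    refine ⟨fun I => {q | F ⟨q, I⟩}, (hV _).2 ((hT' _ _).2 hF), ?_⟩
    ext g
    exact iff_of_eq (hFα g)

/-- A stably compact locale has stably compact locales of generalized valuations if spectra do. -/
theorem isStablyCompact_of_spec {X : Type u} [Order.Frame X] (hX : IsStablyCompact X)
    (T : ∀ (Y : Type u) [Order.Frame Y], GeometricTheory (ValGen Y))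
    (hT : ∀ (Y : Type u) [Order.Frame Y], Axiomatizes.{u, u} n lo hi (T Y))
    (hspec : ∀ (S : Type u) [DistribLattice S] [BoundedOrder S] [StrongProximityLattice S],
      IsStablyCompact (Space (T (Spec S)))) : IsStablyCompact (Space (T X)) := by
  let _ := orderProximity X
  obtain ⟨s, r, hrs⟩ := hX.exists_retraction
  -- Precomposing the universal generalized valuation on `Z` with `φ` gives one on `Y`. Hence the
  -- construction is functorial and carries the retraction of `X` to one of the locales of
  -- valuations.
  have map : ∀ {Y Z : Type u} [Order.Frame Y] [Order.Frame Z] (φ : FrameHom Y Z),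
      ∃ h : FrameHom (Space (T Y)) (Space (T Z)),
        ∀ g : ValGen Y, h (Space.gen (T Y) g) = Space.gen (T Z) ⟨g.rat, φ g.elt⟩ := by
    intro Y Z _ _ φ
    refine ((Space.isPresentedBy.{u, u} (T Y)).2 _
      (fun g => Space.gen (T Z) ⟨g.rat, φ g.elt⟩) ((hT Y _ _).2 ?_)).exists
    have h := (hT Z _ _).1 (Space.isPresentedBy.{u, u} (T Z)).1
    exact ⟨h.bounded.comap φ, h.scott.comap φ, h.modular.comap φ⟩
  obtain ⟨s', hs'⟩ := map s
  obtain ⟨r', hr'⟩ := map r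
  refine (hspec X).of_retract s' r' fun x => ?_
  have e : r'.comp s' = FrameHom.id _ := by
    have hp := Space.isPresentedBy.{u, u} (T X)
    refine (hp.2 _ _ hp.1).unique (fun g => ?_) fun g => rfl
    change r' (s' _) = _
    rw [hs', hr', hrs]
  exact DFunLike.congr_fun e x

end Transfer

/-! ### The four entailment relations as instances -/

section Entailments

variable (S : Type u) [DistribLattice S] [BoundedOrder S]

theorem valEnt_eq : valEnt S = BoundEnt (AddEquiv.refl ℚ) {0} ∅ S := by
  ext A B
  constructor
  · rintro (⟨p, a, h⟩ | ⟨p, h⟩ | ⟨p, q, a, b, h, k⟩)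
    · exact .lo_top 0 p a rfl h
    · exact .lo_bot 0 p rfl h
    · exact .mono p q a b h k
  · rintro (⟨c, p, a, rfl, h⟩ | ⟨c, p, rfl, h⟩ | ⟨c, p, hc, h⟩ | ⟨c, p, a, hc, h⟩ |
      ⟨p, q, a, b, h, k⟩)
    · exact .nonneg p a h
    · exact .bot p h
    · exact hc.elim
    · exact hc.elim
    · exact .mono p q a b h k

theorem valEnt_sup_probValEnt : valEnt S ⊔ probValEnt S = BoundEnt (AddEquiv.refl ℚ) {0} {1} S := by
  ext A B
  constructor
  · rintro ((⟨p, a, h⟩ | ⟨p, h⟩ | ⟨p, q, a, b, h, k⟩) | (⟨p, a, h⟩ | ⟨p, h⟩))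
    · exact .lo_top 0 p a rfl h
    · exact .lo_bot 0 p rfl h
    · exact .mono p q a b h k
    · exact .hi_bot 1 p a rfl h
    · exact .hi_top 1 p rfl h
  · rintro (⟨c, p, a, rfl, h⟩ | ⟨c, p, rfl, h⟩ | ⟨c, p, rfl, h⟩ | ⟨c, p, a, rfl, h⟩ |
      ⟨p, q, a, b, h, k⟩)
    · exact Or.inl (.nonneg p a h)
    · exact Or.inl (.bot p h)
    · exact Or.inr (.one_le p h)
    · exact Or.inr (.le_one p a h)
    · exact Or.inl (.mono p q a b h k)

/-- Under `μ = -ν` the condition `ν 1 = 0` becomes an upper bound `0`. The set `lo` is left free, to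
cover the probabilistic case as well. -/
theorem boundEnt_neg_of_eq {lo hi : Set ℚ} {A B : Finset (ValGen S)} (h : covalEnt S A B)
    (hhi : 0 ∈ hi) : BoundEnt (AddEquiv.neg ℚ) lo hi S A B := by
  obtain ⟨p, a, h⟩ | ⟨p, h⟩ | ⟨p, q, a, b, h, k⟩ := h
  · simpa using BoundEnt.hi_bot (n := AddEquiv.neg ℚ) (lo := lo) 0 (-p) a hhi (by linarith)
  · simpa using BoundEnt.hi_top (n := AddEquiv.neg ℚ) (lo := lo) (S := S) 0 (-p) hhi (by linarith)
  · simpa using BoundEnt.mono (n := AddEquiv.neg ℚ) (lo := lo) (hi := hi) (-p) (-q) a b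
      (by linarith) k

theorem covalEnt_eq : covalEnt S = BoundEnt (AddEquiv.neg ℚ) ∅ {0} S := by
  ext A B
  refine ⟨fun h => boundEnt_neg_of_eq S h rfl, ?_⟩
  rintro (⟨c, p, a, hc, h⟩ | ⟨c, p, hc, h⟩ | ⟨c, p, rfl, h⟩ | ⟨c, p, a, rfl, h⟩ |
    ⟨p, q, a, b, h, k⟩)
  · exact hc.elim
  · exact hc.elim
  · exact .top (-p) (by linarith)
  · exact .nonneg (-p) a (by linarith)
  · exact .mono (-p) (-q) a b (by linarith) k

/-- The total mass `ν 0 = 1` turns into the least value `-1` of `-ν`. -/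
theorem covalEnt_sup_probCovalEnt :
    covalEnt S ⊔ probCovalEnt S = BoundEnt (AddEquiv.neg ℚ) {-1} {0} S := by
  ext A B
  constructor
  · rintro (h | (⟨p, a, h⟩ | ⟨p, h⟩))
    · exact boundEnt_neg_of_eq S h rfl
    · simpa using BoundEnt.lo_top (n := AddEquiv.neg ℚ) (lo := {-1}) (hi := {0}) (-1) (-p) a rfl
        (by linarith)
    · simpa using BoundEnt.lo_bot (n := AddEquiv.neg ℚ) (lo := {-1}) (hi := {0}) (S := S) (-1) (-p)
        rfl (by linarith)
  · rintro (⟨c, p, a, rfl, h⟩ | ⟨c, p, rfl, h⟩ | ⟨c, p, rfl, h⟩ | ⟨c, p, a, rfl, h⟩ |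
      ⟨p, q, a, b, h, k⟩)
    · exact Or.inr (.le_one (-p) a (by linarith))
    · exact Or.inr (.one_le (-p) (by linarith))
    · exact Or.inl (.top (-p) (by linarith))
    · exact Or.inl (.nonneg (-p) a (by linarith))
    · exact Or.inl (.mono (-p) (-q) a b (by linarith) k)

variable [StrongProximityLattice S]

theorem valPrec_eq : valPrec S = GenPrec (AddEquiv.refl ℚ) := by
  ext g h
  exact ⟨fun k => ⟨k.1, k.2⟩, fun k => ⟨k.1, k.2⟩⟩

theorem covalPrec_eq : covalPrec S = GenPrec (AddEquiv.neg ℚ) := by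
  ext g h
  exact ⟨fun k => ⟨neg_lt_neg k.1, k.2⟩, fun k => ⟨neg_lt_neg_iff.1 k.1, k.2⟩⟩

theorem valEntailment_eq :
    valEntailment S = generatedEntailment (valuationEnt (AddEquiv.refl ℚ) {0} ∅ S) := by
  rw [valEntailment, valEnt_eq]

theorem covalEntailment_eq :
    covalEntailment S = generatedEntailment (valuationEnt (AddEquiv.neg ℚ) ∅ {0} S) := by
  rw [covalEntailment, covalEnt_eq]

theorem probValEntailment_eq :
    probValEntailment S = generatedEntailment (valuationEnt (AddEquiv.refl ℚ) {0} {1} S) := by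
  -- The mass axioms are moved past the modular ones, next to the other boundedness axioms.
  rw [probValEntailment, sup_right_comm, sup_right_comm _ _ (probValEnt S), valEnt_sup_probValEnt]

theorem probCovalEntailment_eq :
    probCovalEntailment S = generatedEntailment (valuationEnt (AddEquiv.neg ℚ) {-1} {0} S) := by
  rw [probCovalEntailment, sup_right_comm, sup_right_comm _ _ (probCovalEnt S),
    covalEnt_sup_probCovalEnt]

end Entailments

/-! ### Total mass as an additional bound -/

section Mass

variable {S : Type u} [Lattice S] [BoundedOrder S] {M : Type v} [Order.Frame M] {f : ValGen S → M}

theorem isBoundedFamily_prob_iff :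
    IsBoundedFamily {0} {1} (toFamily (AddEquiv.refl ℚ) f) ↔
      IsBoundedFamily {0} ∅ (toFamily (AddEquiv.refl ℚ) f) ∧
        IsInterpretation (probValTheory S) f := by
  constructor
  · intro h
    refine ⟨⟨h.mono, h.lo_top, h.lo_bot, fun _ hc => hc.elim, fun _ hc => hc.elim⟩, ?_⟩
    rintro _ _ (⟨p, a, hp⟩ | ⟨p, hp⟩)
    · simpa [toFamily] using h.hi_bot 1 rfl p hp a
    · simpa [toFamily] using h.hi_top 1 rfl p hp
  · rintro ⟨h, k⟩
    refine ⟨h.mono, h.lo_top, h.lo_bot, ?_, ?_⟩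
    · rintro _ rfl p hp
      simpa [toFamily] using k _ _ (.one_le p hp)
    · rintro _ rfl p hp a
      simpa [toFamily] using k _ _ (.le_one p a hp)

theorem isBoundedFamily_probCoval_iff :
    IsBoundedFamily {-1} {0} (toFamily (AddEquiv.neg ℚ) f) ↔
      IsBoundedFamily ∅ {0} (toFamily (AddEquiv.neg ℚ) f) ∧
        IsInterpretation (probCovalTheory S) f := by
  constructor
  · intro h
    refine ⟨⟨h.mono, fun _ hc => hc.elim, fun _ hc => hc.elim, h.hi_top, h.hi_bot⟩, ?_⟩
    rintro _ _ (⟨p, a, hp⟩ | ⟨p, hp⟩)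
    · simpa [toFamily] using h.lo_top (-1) rfl (-p) (by linarith) a
    · simpa [toFamily] using h.lo_bot (-1) rfl (-p) (by linarith)
  · rintro ⟨h, k⟩
    refine ⟨h.mono, ?_, ?_, h.hi_top, h.hi_bot⟩
    · rintro _ rfl p hp a
      simpa [toFamily] using k _ _ (.le_one (-p) a (by linarith))
    · rintro _ rfl p hp
      simpa [toFamily] using k _ _ (.one_le (-p) (by linarith))

end Mass

/-! ### The geometric theories over the lattice -/

section OnLattice

variable (S : Type u) [DistribLattice S] [BoundedOrder S] [StrongProximityLattice S]

variable {S} in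
theorem isInterpretation_valBaseTheory {M : Type v} [Order.Frame M] {f : ValGen S → M} :
    IsInterpretation (valBaseTheory S) f ↔
      IsBoundedFamily {0} ∅ (toFamily (AddEquiv.refl ℚ) f) ∧
        IsProximalFamily (toFamily (AddEquiv.refl ℚ) f) := by
  rw [valBaseTheory, isInterpretation_sup, valEnt_eq, valPrec_eq, isInterpretation_boundEnt,
    isInterpretation_genPrec]

variable {S} in
theorem isInterpretation_covalBaseTheory {M : Type v} [Order.Frame M] {f : ValGen S → M} :
    IsInterpretation (covalBaseTheory S) f ↔
      IsBoundedFamily ∅ {0} (toFamily (AddEquiv.neg ℚ) f) ∧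
        IsProximalFamily (toFamily (AddEquiv.neg ℚ) f) := by
  rw [covalBaseTheory, isInterpretation_sup, covalEnt_eq, covalPrec_eq, isInterpretation_boundEnt,
    isInterpretation_genPrec]

theorem axiomatizesOn_valTheory : AxiomatizesOn.{u, w} (AddEquiv.refl ℚ) {0} ∅ (valTheory S) :=
  fun M _ f => by
    rw [valTheory, isInterpretation_sup, isInterpretation_sup, isInterpretation_valBaseTheory,
      isInterpretation_modularTheory₁ (n := AddEquiv.refl ℚ),
      isInterpretation_modularTheory₂ (n := AddEquiv.refl ℚ)]
    exact ⟨fun h => ⟨h.1.1.1, h.1.1.2, h.1.2, h.2⟩, fun h => ⟨⟨⟨h.1, h.2⟩, h.3.1⟩, h.3.2⟩⟩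

theorem axiomatizesOn_covalTheory : AxiomatizesOn.{u, w} (AddEquiv.neg ℚ) ∅ {0} (covalTheory S) :=
  fun M _ f => by
    rw [covalTheory, isInterpretation_sup, isInterpretation_sup, isInterpretation_covalBaseTheory,
      isInterpretation_modularTheory₁ (n := AddEquiv.neg ℚ),
      isInterpretation_modularTheory₂ (n := AddEquiv.neg ℚ)]
    exact ⟨fun h => ⟨h.1.1.1, h.1.1.2, h.1.2, h.2⟩, fun h => ⟨⟨⟨h.1, h.2⟩, h.3.1⟩, h.3.2⟩⟩

theorem axiomatizesOn_probValTheory :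
    AxiomatizesOn.{u, w} (AddEquiv.refl ℚ) {0} {1} (valTheory S ⊔ probValTheory S) :=
  fun M _ f => by
    rw [isInterpretation_sup, axiomatizesOn_valTheory S M f]
    exact ⟨fun h => ⟨isBoundedFamily_prob_iff.2 ⟨h.1.1, h.2⟩, h.1.2, h.1.3⟩, fun h =>
      ⟨⟨(isBoundedFamily_prob_iff.1 h.1).1, h.2, h.3⟩, (isBoundedFamily_prob_iff.1 h.1).2⟩⟩

theorem axiomatizesOn_probCovalTheory :
    AxiomatizesOn.{u, w} (AddEquiv.neg ℚ) {-1} {0} (covalTheory S ⊔ probCovalTheory S) :=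
  fun M _ f => by
    rw [isInterpretation_sup, axiomatizesOn_covalTheory S M f]
    exact ⟨fun h => ⟨isBoundedFamily_probCoval_iff.2 ⟨h.1.1, h.2⟩, h.1.2, h.1.3⟩, fun h =>
      ⟨⟨(isBoundedFamily_probCoval_iff.1 h.1).1, h.2, h.3⟩,
        (isBoundedFamily_probCoval_iff.1 h.1).2⟩⟩

end OnLattice

/-! ### The geometric theories over a frame -/

section OnFrame

variable (X : Type u) [Order.Frame X]

theorem axiomatizes_valuationTheory :
    Axiomatizes.{u, w} (AddEquiv.refl ℚ) {0} ∅ (valuationTheory X) := fun M _ f => by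
  rw [valuationTheory, isInterpretation_sup, isInterpretation_sup,
    isInterpretation_modularTheory₁ (n := AddEquiv.refl ℚ),
    isInterpretation_modularTheory₂ (n := AddEquiv.refl ℚ)]
  constructor
  · rintro ⟨⟨h, h₁⟩, h₂⟩
    refine ⟨⟨fun {p q a b} hqp hab => by simpa [toFamily] using h _ _ (.mono p q a b hqp hab), ?_, ?_,
      fun _ hc => hc.elim, fun _ hc => hc.elim⟩, ⟨fun p x => ?_, fun p D hD hdir => ?_⟩, h₁, h₂⟩
    · rintro _ rfl p hp x
      simpa [toFamily] using h _ _ (.nonneg p x hp)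
    · rintro _ rfl p hp
      simpa [toFamily] using h _ _ (.bot p hp)
    · have := h _ _ (.round p x)
      rw [Finset.inf_singleton] at this
      refine this.trans (iSup₂_le ?_)
      rintro _ ⟨q, hq, rfl⟩
      rw [Finset.inf_singleton]
      exact le_iSup₂_of_le (f := fun q (_ : p < q) => f ⟨q, x⟩) q hq le_rfl
    · have := h _ _ (.scott p D hD hdir)
      rw [Finset.inf_singleton] at this
      refine this.trans (iSup₂_le ?_)
      rintro _ ⟨x, hx, rfl⟩
      rw [Finset.inf_singleton]
      exact le_iSup₂_of_le (f := fun x (_ : x ∈ D) => f ⟨p, x⟩) x hx le_rfl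
  · rintro ⟨hb, hs, hm⟩
    refine ⟨⟨?_, hm.1⟩, hm.2⟩
    rintro _ _ (⟨p, x, hp⟩ | ⟨p, hp⟩ | ⟨p, q, x, y, hqp, hxy⟩ | ⟨p, x⟩ | ⟨p, D, hD, hdir⟩)
    · simpa [toFamily] using hb.lo_top 0 rfl p hp x
    · simpa [toFamily] using hb.lo_bot 0 rfl p hp
    · simpa [toFamily] using hb.mono hqp hxy
    · rw [Finset.inf_singleton]
      refine (hs.round p x).trans (iSup₂_le fun q hq => ?_)
      exact le_iSup₂_of_le {⟨q, x⟩} ⟨q, hq, rfl⟩ (Finset.inf_singleton (f := f)).ge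
    · rw [Finset.inf_singleton]
      refine (hs.scott p D hD hdir).trans (iSup₂_le fun x hx => ?_)
      exact le_iSup₂_of_le {⟨p, x⟩} ⟨x, hx, rfl⟩ (Finset.inf_singleton (f := f)).ge

theorem axiomatizes_covaluationTheory :
    Axiomatizes.{u, w} (AddEquiv.neg ℚ) ∅ {0} (covaluationTheory X) := fun M _ f => by
  rw [covaluationTheory, isInterpretation_sup, isInterpretation_sup,
    isInterpretation_modularTheory₁ (n := AddEquiv.neg ℚ),
    isInterpretation_modularTheory₂ (n := AddEquiv.neg ℚ)]
  constructor
  · rintro ⟨⟨h, h₁⟩, h₂⟩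
    refine ⟨⟨fun {p q a b} hqp hab => by simpa [toFamily] using h _ _ (.mono (-p) (-q) a b (by linarith) hab),
      fun _ hc => hc.elim, fun _ hc => hc.elim, ?_, ?_⟩,
      ⟨fun p x => ?_, fun p D hD hdir => ?_⟩, h₁, h₂⟩
    · rintro _ rfl p hp
      simpa [toFamily] using h _ _ (.top (-p) (by linarith))
    · rintro _ rfl p hp x
      simpa [toFamily] using h _ _ (.nonneg (-p) x (by linarith))
    · have := h _ _ (.round (-p) x)
      rw [Finset.inf_singleton] at this
      refine this.trans (iSup₂_le ?_)
      rintro _ ⟨q, hq, rfl⟩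
      rw [Finset.inf_singleton]
      exact le_iSup₂_of_le (f := fun q (_ : p < q) => f ⟨-q, x⟩) (-q) (by linarith) (by simp)
    · have := h _ _ (.scott (-p) D hD hdir)
      rw [Finset.inf_singleton] at this
      refine this.trans (iSup₂_le ?_)
      rintro _ ⟨x, hx, rfl⟩
      rw [Finset.inf_singleton]
      exact le_iSup₂_of_le (f := fun x (_ : x ∈ D) => f ⟨-p, x⟩) x hx le_rfl
  · rintro ⟨hb, hs, hm⟩
    refine ⟨⟨?_, hm.1⟩, hm.2⟩
    rintro _ _ (⟨p, x, hp⟩ | ⟨p, hp⟩ | ⟨p, q, x, y, hqp, hxy⟩ | ⟨p, x⟩ | ⟨p, D, hD, hdir⟩)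
    · simpa [toFamily] using hb.hi_bot 0 rfl (-p) (by linarith) x
    · simpa [toFamily] using hb.hi_top 0 rfl (-p) (by linarith)
    · simpa [toFamily] using hb.mono (neg_le_neg hqp) hxy
    · rw [Finset.inf_singleton]
      have h := hs.round (-p) x
      simp only [toFamily, AddEquiv.neg_apply, neg_neg] at h
      refine h.trans (iSup₂_le fun q hq => ?_)
      exact le_iSup₂_of_le {⟨-q, x⟩} ⟨-q, by linarith, rfl⟩ (Finset.inf_singleton (f := f)).ge
    · rw [Finset.inf_singleton]
      have h := hs.scott (-p) D hD hdir
      simp only [toFamily, AddEquiv.neg_apply, neg_neg] at h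
      refine h.trans (iSup₂_le fun x hx => ?_)
      exact le_iSup₂_of_le {⟨p, x⟩} ⟨x, hx, rfl⟩ (Finset.inf_singleton (f := f)).ge

theorem axiomatizes_probValuationTheory :
    Axiomatizes.{u, w} (AddEquiv.refl ℚ) {0} {1} (probValuationTheory X) := fun M _ f => by
  rw [probValuationTheory, isInterpretation_sup, axiomatizes_valuationTheory X M f]
  exact ⟨fun h => ⟨isBoundedFamily_prob_iff.2 ⟨h.1.1, h.2⟩, h.1.2, h.1.3⟩, fun h =>
    ⟨⟨(isBoundedFamily_prob_iff.1 h.1).1, h.2, h.3⟩, (isBoundedFamily_prob_iff.1 h.1).2⟩⟩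

theorem axiomatizes_probCovaluationTheory :
    Axiomatizes.{u, w} (AddEquiv.neg ℚ) {-1} {0} (probCovaluationTheory X) := fun M _ f => by
  rw [probCovaluationTheory, isInterpretation_sup, axiomatizes_covaluationTheory X M f]
  exact ⟨fun h => ⟨isBoundedFamily_probCoval_iff.2 ⟨h.1.1, h.2⟩, h.1.2, h.1.3⟩, fun h =>
    ⟨⟨(isBoundedFamily_probCoval_iff.1 h.1).1, h.2, h.3⟩, (isBoundedFamily_probCoval_iff.1 h.1).2⟩⟩

end OnFrame

/-! ### Valuations as interpretations in truth values -/

section Points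

variable {X : Type u} {n : ℚ ≃+ ℚ}

/-- The truth values of `q ∈ μ x`, as a map on generators. -/
abbrev memGen (μ : X → Set ℚ) (g : ValGen X) : Prop := g.rat ∈ μ g.elt

/-- In `Prop` joins are existential quantifiers, so the geometric inequality becomes containment of
pointwise sums; additivity of `n` matches the equations between the rationals. -/
theorem sumLE_memGen_iff {μ : X → Set ℚ} {a b c d : X} :
    SumLE (toFamily n (memGen μ)) a b c d ↔
      Set.image2 (· + ·) (μ a) (μ b) ⊆ Set.image2 (· + ·) (μ c) (μ d) := by
  constructor
  · rintro h _ ⟨p, hp, q, hq, rfl⟩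
    obtain ⟨p, rfl⟩ := n.surjective p
    obtain ⟨q, rfl⟩ := n.surjective q
    have := h p q ⟨hp, hq⟩
    simp only [iSup_Prop_eq] at this
    obtain ⟨p', q', e, hp', hq'⟩ := this
    exact ⟨n p', hp', n q', hq', by simp only [← map_add, e]⟩
  · rintro h p q ⟨hp, hq⟩
    obtain ⟨p', hp', q', hq', e⟩ := h ⟨n p, hp, n q, hq, rfl⟩
    obtain ⟨p', rfl⟩ := n.surjective p'
    obtain ⟨q', rfl⟩ := n.surjective q'
    simp only [← map_add, n.injective.eq_iff] at e
    simp only [iSup_Prop_eq]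
    exact ⟨p', q', e, hp', hq'⟩

theorem isModularFamily_memGen_iff [Lattice X] {μ : X → Set ℚ} :
    IsModularFamily (toFamily n (memGen μ)) ↔ IsModular μ := by
  constructor
  · exact fun h x y => Set.Subset.antisymm (sumLE_memGen_iff.1 (h.1 x y))
      (sumLE_memGen_iff.1 (h.2 x y))
  · exact fun h => ⟨fun x y => sumLE_memGen_iff.2 (h x y).subset,
      fun x y => sumLE_memGen_iff.2 (h x y).superset⟩

/-- Monotonicity comes from Scott continuity on the directed set `{x, y}`, whose join is `y`. -/
theorem IsScottCont.subset [CompleteLattice X] {μ : X → Set ℚ} (h : IsScottCont μ) {x y : X}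
    (hxy : x ≤ y) : μ x ⊆ μ y := by
  have hdir : DirectedOn (· ≤ ·) ({x, y} : Set X) := by
    rintro a ha b hb
    refine ⟨y, by simp, ?_, ?_⟩
    · rcases ha with rfl | rfl
      exacts [hxy, le_rfl]
    · rcases hb with rfl | rfl
      exacts [hxy, le_rfl]
  have e := h {x, y} ⟨x, by simp⟩ hdir
  rw [sSup_pair, sup_eq_right.2 hxy] at e
  rw [e]
  exact Set.subset_biUnion_of_mem (u := fun x => μ x) (Set.mem_insert x {y})

variable [Order.Frame X]

theorem isScottFamily_memGen_iff {lo hi : Set ℚ} {μ : X → Set ℚ}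
    (hb : IsBoundedFamily lo hi (toFamily n (memGen μ))) :
    IsScottFamily (toFamily n (memGen μ)) ↔
      (∀ p x, n p ∈ μ x → ∃ q, p < q ∧ n q ∈ μ x) ∧ IsScottCont μ := by
  constructor
  · intro h
    refine ⟨fun p x hp => ?_, fun D hD hdir => Set.Subset.antisymm (fun q hq => ?_) ?_⟩
    · have := h.round p x hp
      simpa only [iSup_Prop_eq, exists_prop] using this
    · obtain ⟨q, rfl⟩ := n.surjective q
      have := h.scott q D hD hdir hq
      simpa only [iSup_Prop_eq, Set.mem_iUnion] using this
    · refine Set.iUnion₂_subset fun x hx q hq => ?_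
      obtain ⟨q, rfl⟩ := n.surjective q
      exact hb.mono (le_refl q) (le_sSup hx) hq
  · rintro ⟨h, k⟩
    refine ⟨fun p x hp => ?_, fun p D hD hdir hp => ?_⟩
    · simp only [iSup_Prop_eq, exists_prop]
      exact h p x hp
    · change n p ∈ μ (sSup D) at hp
      rw [k D hD hdir] at hp
      simpa only [iSup_Prop_eq, Set.mem_iUnion] using hp

theorem isValuation_iff {μ : X → Set ℚ} :
    IsValuation μ ↔ IsInterpretation (valuationTheory X) (memGen μ) := by
  rw [axiomatizes_valuationTheory X]
  constructor
  · intro h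
    have hdown : ∀ {x p q}, q ≤ p → p ∈ μ x → q ∈ μ x := fun {x p q} hqp hp => by
      rcases hqp.eq_or_lt with rfl | hlt
      · exact hp
      · exact (h.isLowerReal x q).2 ⟨p, hp, hlt⟩
    have hb : IsBoundedFamily {0} ∅ (toFamily (AddEquiv.refl ℚ) (memGen μ)) := by
      refine ⟨fun hqp hab hp => hdown hqp (h.scottCont.subset hab hp), ?_, ?_,
        fun _ hc => hc.elim, fun _ hc => hc.elim⟩
      · rintro _ rfl p hp a
        exact eq_true (h.nonneg a hp)
      · rintro _ rfl p hp
        refine eq_false fun hmem : p ∈ μ ⊥ => ?_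
        rw [h.bot] at hmem
        exact lt_asymm hp hmem
    refine ⟨hb, (isScottFamily_memGen_iff hb).2 ⟨fun p x hp => ?_, h.scottCont⟩,
      isModularFamily_memGen_iff.2 h.modular⟩
    obtain ⟨q, hq, hpq⟩ := (h.isLowerReal x p).1 hp
    exact ⟨q, hpq, hq⟩
  · rintro ⟨hb, hs, hm⟩
    obtain ⟨hround, hscott⟩ := (isScottFamily_memGen_iff hb).1 hs
    refine ⟨fun x q => ⟨fun hq => ?_, ?_⟩, fun x p hp => ?_, hscott, ?_,
      isModularFamily_memGen_iff.1 hm⟩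
    · obtain ⟨r, hqr, hr⟩ := hround q x hq
      exact ⟨r, hr, hqr⟩
    · rintro ⟨r, hr, hqr⟩
      exact hb.mono hqr.le (le_refl x) hr
    · exact of_eq_true (hb.lo_top 0 rfl p hp x)
    · refine Set.Subset.antisymm (fun q hq => ?_) fun q hq => of_eq_true (hb.lo_top 0 rfl q hq ⊥)
      -- The axioms exclude only positive rationals from `μ ⊥`; roundedness also excludes `0`.
      obtain ⟨r, hqr, hr⟩ := hround q ⊥ hq
      by_contra hq0
      exact of_eq_false (hb.lo_bot 0 rfl r ((not_lt.1 hq0).trans_lt hqr)) hr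

theorem isCovaluation_iff {ν : X → Set ℚ} :
    IsCovaluation ν ↔ IsInterpretation (covaluationTheory X) (memGen ν) := by
  rw [axiomatizes_covaluationTheory X]
  constructor
  · intro h
    have hup : ∀ {x p q}, p ≤ q → p ∈ ν x → q ∈ ν x := fun {x p q} hpq hp => by
      rcases hpq.eq_or_lt with rfl | hlt
      · exact hp
      · exact (h.isUpperReal x q).2 ⟨p, hp, hlt⟩
    have hb : IsBoundedFamily ∅ {0} (toFamily (AddEquiv.neg ℚ) (memGen ν)) := by
      refine ⟨fun hqp hab hp => hup (neg_le_neg hqp) (h.scottCont.subset hab hp),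
        fun _ hc => hc.elim, fun _ hc => hc.elim, ?_, ?_⟩
      · rintro _ rfl p hp
        refine eq_true (?_ : -p ∈ ν ⊤)
        rw [h.top]
        exact neg_pos.2 hp
      · rintro _ rfl p hp a
        exact eq_false fun hmem : -p ∈ ν a => lt_asymm hp (neg_pos.1 (h.nonneg a hmem))
    refine ⟨hb, (isScottFamily_memGen_iff hb).2 ⟨fun p x hp => ?_, h.scottCont⟩,
      isModularFamily_memGen_iff.2 h.modular⟩
    obtain ⟨q, hq, hqp⟩ := (h.isUpperReal x (-p)).1 hp
    exact ⟨-q, lt_neg_of_lt_neg hqp, by simpa using hq⟩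
  · rintro ⟨hb, hs, hm⟩
    obtain ⟨hround, hscott⟩ := (isScottFamily_memGen_iff hb).1 hs
    have hround' : ∀ {x q}, q ∈ ν x → ∃ r ∈ ν x, r < q := fun {x q} hq => by
      obtain ⟨r, hqr, hr⟩ := hround (-q) x (by simpa using hq)
      exact ⟨-r, hr, neg_lt.1 hqr⟩
    have htop : ∀ q : ℚ, 0 < q → q ∈ ν ⊤ := fun q hq => by
      have : - -q ∈ ν ⊤ := of_eq_true (hb.hi_top 0 rfl (-q) (neg_lt_zero.2 hq))
      rwa [neg_neg] at this
    have hnonneg : ∀ {x q}, q ∈ ν x → 0 < q := fun {x q} hq => by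
      -- The axioms exclude only negative rationals; rounding down excludes `0` as well.
      obtain ⟨r, hr, hrq⟩ := hround' hq
      by_contra hq0
      refine of_eq_false (hb.hi_bot 0 rfl (-r) ?_ x) (?_ : - -r ∈ ν x)
      · linarith
      · rwa [neg_neg]
    refine ⟨fun x q => ⟨hround', ?_⟩, fun x q => hnonneg, hscott,
      Set.Subset.antisymm (fun q => hnonneg) htop, isModularFamily_memGen_iff.1 hm⟩
    rintro ⟨r, hr, hrq⟩
    have : - -q ∈ ν x := hb.mono (neg_le_neg hrq.le) (le_refl x) (show - -r ∈ ν x by rwa [neg_neg])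
    rwa [neg_neg] at this

theorem isProbValuation_iff {μ : X → Set ℚ} :
    IsProbValuation μ ↔ IsInterpretation (probValuationTheory X) (memGen μ) := by
  rw [probValuationTheory, isInterpretation_sup, ← isValuation_iff]
  constructor
  · intro h
    refine ⟨h.toIsValuation, ?_⟩
    rintro _ _ (⟨p, a, hp⟩ | ⟨p, hp⟩)
    · rw [Finset.inf_singleton]
      intro hmem
      have : p ∈ μ ⊤ := h.scottCont.subset le_top hmem
      rw [h.mass] at this
      exact (lt_asymm hp this).elim
    · have : p ∈ μ ⊤ := by rw [h.mass]; exact hp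
      simpa using this
  · rintro ⟨h, k⟩
    refine ⟨h, Set.Subset.antisymm (fun q hq => ?_) fun q hq => ?_⟩
    · obtain ⟨r, hr, hqr⟩ := (h.isLowerReal ⊤ q).1 hq
      by_contra hq1
      have := k _ _ (.le_one r ⊤ ((not_lt.1 hq1).trans_lt hqr))
      simp [hr] at this
    · simpa using k _ _ (.one_le q hq)

theorem isProbCovaluation_iff {ν : X → Set ℚ} :
    IsProbCovaluation ν ↔ IsInterpretation (probCovaluationTheory X) (memGen ν) := by
  rw [probCovaluationTheory, isInterpretation_sup, ← isCovaluation_iff]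
  constructor
  · intro h
    refine ⟨h.toIsCovaluation, ?_⟩
    rintro _ _ (⟨p, a, hp⟩ | ⟨p, hp⟩)
    · have h1 : p ∈ ν ⊥ := by rw [h.mass]; exact hp
      have : p ∈ ν a := h.scottCont.subset bot_le h1
      simpa using this
    · rw [Finset.inf_singleton]
      intro hmem
      have : p ∈ ν ⊥ := hmem
      rw [h.mass] at this
      exact (lt_asymm hp this).elim
  · rintro ⟨h, k⟩
    refine ⟨h, Set.Subset.antisymm (fun q hq => ?_) fun q hq => ?_⟩
    · obtain ⟨r, hr, hrq⟩ := (h.isUpperReal ⊥ q).1 hq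
      by_contra hq1
      have := k _ _ (.one_le r (hrq.trans_le (not_lt.1 hq1)))
      simp [hr] at this
    · simpa using k _ _ (.le_one q ⊥ hq)

end Points

/-! ### Presentation and stable compactness over the spectrum -/

section Spectrum

variable {S : Type u} [DistribLattice S] [BoundedOrder S] [StrongProximityLattice S]
  {n : ℚ ≃+ ℚ} {lo hi : Set ℚ} {T : GeometricTheory (ValGen (Spec S))}
  {E : Finset (ValGen S) → Finset (ValGen S) → Prop} {r : ValGen S → ValGen S → Prop}

theorem axiomatizesOn_contEntTheory (hb : (lo ∪ hi).Nonempty)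
    (hE : E = generatedEntailment (valuationEnt n lo hi S)) (hr : r = GenPrec n) :
    AxiomatizesOn.{u, w} n lo hi (contEntTheory E r) := fun M _ f => by
  rw [hE, hr]
  exact isInterpretation_contEntTheory hb

/-- The locale of generalized valuations on `Spec S` is presented by a strong continuous entailment
relation, whose models are the generalized valuations. -/
theorem strongContEnt_presentation (hb : (lo ∪ hi).Nonempty)
    (hE : E = generatedEntailment (valuationEnt n lo hi S)) (hr : r = GenPrec n)
    (hTw : Axiomatizes.{u, w} n lo hi T) (hTu : Axiomatizes.{u, u} n lo hi T)
    (hT₀ : Axiomatizes.{u, 0} n lo hi T) {V : (Spec S → Set ℚ) → Prop}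
    (hV : ∀ μ, V μ ↔ IsInterpretation T (memGen μ)) :
    IsStrongContEnt E r ∧
      IsPresentedBy.{u, u, w} (contEntTheory E r) (fun g => Space.gen T g.toSpec) ∧
      Set.BijOn (modelOf (S := S)) {μ | V μ} {α | IsModel (contEntTheory E r) α} := by
  refine ⟨?_, AxiomatizesOn.isPresentedBy (axiomatizesOn_contEntTheory hb hE hr)
    (axiomatizesOn_contEntTheory hb hE hr) hTw hTu,
    bijOn_modelOf (axiomatizesOn_contEntTheory hb hE hr) hT₀ hV⟩
  rw [hE, hr]
  exact isStrongContEnt_valuationEnt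

theorem isStablyCompact_space_spec (hb : (lo ∪ hi).Nonempty)
    (hT : Axiomatizes.{u, u} n lo hi T) : IsStablyCompact (Space T) :=
  (isStrongContEnt_valuationEnt (n := n) (lo := lo) (hi := hi)).isStablyCompact
    (AxiomatizesOn.isPresentedBy (axiomatizesOn_contEntTheory (S := S) hb rfl rfl)
      (axiomatizesOn_contEntTheory hb rfl rfl) hT hT)

end Spectrum

end PointFree

/-! ### The main theorem -/

theorem mainTheorem9 :
    (∀ (S : Type u) [DistribLattice S] [BoundedOrder S] [StrongProximityLattice S],
      -- under the other axioms, the modular law is equivalent to the finitary axioms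
      (∀ (L : Type v) [Order.Frame L] (f : ValGen S → L),
        IsInterpretation (valBaseTheory S) f ∨ IsInterpretation (covalBaseTheory S) f →
          (IsInterpretation (modularTheory₁ S) f ↔
            IsInterpretation (finitaryTheory (disjEnt₁ S)) f) ∧
          (IsInterpretation (modularTheory₂ S) f ↔
            IsInterpretation (finitaryTheory (disjEnt₂ S)) f)) ∧
      -- the locale of valuations on `Spec S`
      (IsPresentedBy.{u, u, v} (valTheory S)
          (fun g => Space.gen (valuationTheory (Spec S)) g.toSpec) ∧
        IsStrongContEnt (valEntailment S) (valPrec S) ∧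
        IsPresentedBy.{u, u, v} (contEntTheory (valEntailment S) (valPrec S))
          (fun g => Space.gen (valuationTheory (Spec S)) g.toSpec) ∧
        Set.BijOn (modelOf (S := S)) {μ | IsValuation μ}
          {α | IsModel (contEntTheory (valEntailment S) (valPrec S)) α}) ∧
      -- the locale of covaluations on `Spec S`
      (IsPresentedBy.{u, u, v} (covalTheory S)
          (fun g => Space.gen (covaluationTheory (Spec S)) g.toSpec) ∧
        IsStrongContEnt (covalEntailment S) (covalPrec S) ∧
        IsPresentedBy.{u, u, v} (contEntTheory (covalEntailment S) (covalPrec S))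
          (fun g => Space.gen (covaluationTheory (Spec S)) g.toSpec) ∧
        Set.BijOn (modelOf (S := S)) {ν | IsCovaluation ν}
          {α | IsModel (contEntTheory (covalEntailment S) (covalPrec S)) α}) ∧
      -- the locale of probabilistic valuations on `Spec S`
      (IsPresentedBy.{u, u, v} (valTheory S ⊔ probValTheory S)
          (fun g => Space.gen (probValuationTheory (Spec S)) g.toSpec) ∧
        IsStrongContEnt (probValEntailment S) (valPrec S) ∧
        IsPresentedBy.{u, u, v} (contEntTheory (probValEntailment S) (valPrec S))
          (fun g => Space.gen (probValuationTheory (Spec S)) g.toSpec) ∧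
        Set.BijOn (modelOf (S := S)) {μ | IsProbValuation μ}
          {α | IsModel (contEntTheory (probValEntailment S) (valPrec S)) α}) ∧
      -- the locale of probabilistic covaluations on `Spec S`
      (IsPresentedBy.{u, u, v} (covalTheory S ⊔ probCovalTheory S)
          (fun g => Space.gen (probCovaluationTheory (Spec S)) g.toSpec) ∧
        IsStrongContEnt (probCovalEntailment S) (covalPrec S) ∧
        IsPresentedBy.{u, u, v} (contEntTheory (probCovalEntailment S) (covalPrec S))
          (fun g => Space.gen (probCovaluationTheory (Spec S)) g.toSpec) ∧
        Set.BijOn (modelOf (S := S)) {ν | IsProbCovaluation ν}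
          {α | IsModel (contEntTheory (probCovalEntailment S) (covalPrec S)) α}) ∧
      -- these locales are stably compact
      IsStablyCompact (Valuations (Spec S)) ∧ IsStablyCompact (Covaluations (Spec S)) ∧
      IsStablyCompact (ProbValuations (Spec S)) ∧
      IsStablyCompact (ProbCovaluations (Spec S))) ∧
    -- the corresponding locales over any stably compact locale are stably compact
    (∀ (X : Type u) [Order.Frame X], IsStablyCompact X →
      IsStablyCompact (Valuations X) ∧ IsStablyCompact (Covaluations X) ∧
      IsStablyCompact (ProbValuations X) ∧ IsStablyCompact (ProbCovaluations X)) := by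
  have hlo : ∀ {hi : Set ℚ}, ({0} ∪ hi : Set ℚ).Nonempty := fun {_} => ⟨0, Or.inl rfl⟩
  have hhi : ∀ {lo : Set ℚ}, (lo ∪ {0} : Set ℚ).Nonempty := fun {_} => ⟨0, Or.inr rfl⟩
  refine ⟨fun S _ _ _ => ⟨fun L _ f hf => ?_, ⟨?_, ?_⟩, ⟨?_, ?_⟩, ⟨?_, ?_⟩, ⟨?_, ?_⟩,
    isStablyCompact_space_spec hlo (axiomatizes_valuationTheory _),
    isStablyCompact_space_spec hhi (axiomatizes_covaluationTheory _),
    isStablyCompact_space_spec hlo (axiomatizes_probValuationTheory _),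
    isStablyCompact_space_spec hhi (axiomatizes_probCovaluationTheory _)⟩,
    fun X _ hX => ⟨?_, ?_, ?_, ?_⟩⟩
  · rcases hf with hf | hf
    · obtain ⟨hb, hp⟩ := isInterpretation_valBaseTheory.1 hf
      exact isInterpretation_modularTheory_iff_disjEnt hlo hb hp
    · obtain ⟨hb, hp⟩ := isInterpretation_covalBaseTheory.1 hf
      exact isInterpretation_modularTheory_iff_disjEnt hhi hb hp
  · exact (axiomatizesOn_valTheory S).isPresentedBy (axiomatizesOn_valTheory S)
      (axiomatizes_valuationTheory _) (axiomatizes_valuationTheory _)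
  · exact strongContEnt_presentation hlo (valEntailment_eq S) (valPrec_eq S)
      (axiomatizes_valuationTheory _) (axiomatizes_valuationTheory _)
      (axiomatizes_valuationTheory _) fun _ => isValuation_iff
  · exact (axiomatizesOn_covalTheory S).isPresentedBy (axiomatizesOn_covalTheory S)
      (axiomatizes_covaluationTheory _) (axiomatizes_covaluationTheory _)
  · exact strongContEnt_presentation hhi (covalEntailment_eq S) (covalPrec_eq S)
      (axiomatizes_covaluationTheory _) (axiomatizes_covaluationTheory _)
      (axiomatizes_covaluationTheory _) fun _ => isCovaluation_iff
  · exact (axiomatizesOn_probValTheory S).isPresentedBy (axiomatizesOn_probValTheory S)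
      (axiomatizes_probValuationTheory _) (axiomatizes_probValuationTheory _)
  · exact strongContEnt_presentation hlo (probValEntailment_eq S) (valPrec_eq S)
      (axiomatizes_probValuationTheory _) (axiomatizes_probValuationTheory _)
      (axiomatizes_probValuationTheory _) fun _ => isProbValuation_iff
  · exact (axiomatizesOn_probCovalTheory S).isPresentedBy (axiomatizesOn_probCovalTheory S)
      (axiomatizes_probCovaluationTheory _) (axiomatizes_probCovaluationTheory _)
  · exact strongContEnt_presentation hhi (probCovalEntailment_eq S) (covalPrec_eq S)
      (axiomatizes_probCovaluationTheory _) (axiomatizes_probCovaluationTheory _)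
      (axiomatizes_probCovaluationTheory _) fun _ => isProbCovaluation_iff
  · exact isStablyCompact_of_spec hX (fun Y _ => valuationTheory Y)
      (fun Y _ => axiomatizes_valuationTheory Y)
      fun S _ _ _ => isStablyCompact_space_spec hlo (axiomatizes_valuationTheory _)
  · exact isStablyCompact_of_spec hX (fun Y _ => covaluationTheory Y)
      (fun Y _ => axiomatizes_covaluationTheory Y)
      fun S _ _ _ => isStablyCompact_space_spec hhi (axiomatizes_covaluationTheory _)
  · exact isStablyCompact_of_spec hX (fun Y _ => probValuationTheory Y)
      (fun Y _ => axiomatizes_probValuationTheory Y)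
      fun S _ _ _ => isStablyCompact_space_spec hlo (axiomatizes_probValuationTheory _)
  · exact isStablyCompact_of_spec hX (fun Y _ => probCovaluationTheory Y)
      (fun Y _ => axiomatizes_probCovaluationTheory Y)
      fun S _ _ _ => isStablyCompact_space_spec hhi (axiomatizes_probCovaluationTheory _)
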